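/- **Conventions.** $\mathbb N=\{1,2,\dots\}$. Let $X$ be an infinite compact metric space and $\varphi:X\to X$ a homeomorphism such that $(X,\varphi)$ is a *Smale space*: there are constants $\varepsilon_X>0$, $\lambda_X>1$ and a continuous bracket $\{(x,y):d(x,y)\le\varepsilon_X\}\to X$, $(x,y)\mapsto[x,y]$, with $[x,x]=x$, $[x,[y,z]]=[x,z]$, $[[x,y],z]=[x,z]$, $\varphi[x,y]=[\varphi(x),\varphi(y)]$ whenever both sides are defined, such that, with $X^s(x,r)=\{y:d(x,y)<r,\ [x,y]=y\}$ and $X^u(x,r)=\{y:d(x,y)<r,\ [y,x]=y\}$ for $0<r\le\varepsilon_X$, one has $d(\varphi(y),\varphi(z))\le\lambda_X^{-1}d(y,z)$ for $y,z\in X^s(x,r)$ and $d(\varphi^{-1}(y),\varphi^{-1}(z))\le\lambda_X^{-1}d(y,z)$ for $y,z\in X^u(x,r)$. Assume that $(X,\varphi)$ is *irreducible*: for all non-empty open $U,V\subset X$ there is $n\in\mathbb N$ with $\varphi^n(U)\cap V\neq\varnothing$. Fix $0<\varepsilon_X'\le\varepsilon_X/2$ such that $d(x,y)\le\varepsilon_X'$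 implies $d(x,[x,y])<\varepsilon_X/2$ and $d(y,[x,y])<\varepsilon_X/2$, and $0<\varepsilon_X''<\varepsilon_X'/12$ such that $d(x,y)\le\varepsilon_X''$ implies $d(\varphi^i(x),\varphi^i(y))\le\varepsilon_X'/2$ for $|i|\le2$, $d([x,y],y)\le\varepsilon_X'/4$ and $d([x,y],x)\le\varepsilon_X'/4$. A *rectangle* is a non-empty $R\subset X$ with $\operatorname{diam}R\le\varepsilon_X'$ and $[x,y]\in R$ for all $x,y\in R$; it is *proper* if it is closed and $R=\operatorname{cl}(\operatorname{int}R)$. Put $X^{s}(x,R)=X^{s}(x,2\varepsilon_X')\cap R$ and $X^{u}(x,R)=X^{u}(x,2\varepsilon_X')\cap R$. A *Markov partition* is a finite cover of $X$ by proper rectangles such that different members have disjoint interiors, and for all members $R,T$ and all $x\in\operatorname{int}R\cap\varphi^{-1}(\operatorname{int}T)$ one has $\varphi(X^u(x,R))\supset X^u(\varphi(x),T)$ and $\varphi(X^s(x,R))\subset X^s(\varphi(x),T)$. For families of sets put $\bigvee_{i\in I}\mathcal U_i=\{\bigcap_{i\in I}U_i:U_i\in\mathcal U_i\}$ and $\varphi^{-i}(\mathcal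 U)=\{\varphi^{-i}(U):U\in\mathcal U\}$. Let $\mathcal R_1=\{R_1,\dots,R_\ell\}$ (with different $R_i$) be a Markov partition all of whose members have diameter at most $\varepsilon_X''$, let $\mathcal R_0=\{X\}$ and, for $n\in\mathbb N$, $$\mathcal R_n=\Big\{R\in\bigvee_{i=1-n}^{n-1}\varphi^{-i}(\mathcal R_1):\operatorname{int}(R)\ne\varnothing\Big\}.$$ The topological entropy $\operatorname{h}(\varphi)$ is the supremum over finite open covers $\mathcal U$ of $\lim_n\frac1n\log N(\bigvee_{i=0}^{n-1}\varphi^{-i}(\mathcal U))$, where $N$ is the minimal cardinality of a subcover. A sequence $(\mathcal V_n)_{n\ge0}$ of finite covers of $X$, all open or all closed with non-empty interiors, is *refining* if $\mathcal V_0=\{X\}$, each element of $\mathcal V_{n+1}$ lies in an element of $\mathcal V_n$, and the largest diameter of an element of $\mathcal V_n$ tends to $0$. Its *approximation graph* has vertex set $\coprod_n\mathcal V_n$, root $X$, and an edge from $v\in\mathcal V_n$ to $w\in\mathcal V_{n+1}$ exactly when $w\subset v$; it is required to have no sinks and no source except the root. The graph is *essential* if it consists of closed covers and for every $n\in\mathbb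 N$: each $v\in\mathcal V_n$ is the union of the $w\in\mathcal V_{n+1}$ with $w\subset v$; each set $v^{\mathrm{ess}}=\operatorname{int}(v)\setminus\bigcup\{\operatorname{cl}(u)\cap\operatorname{cl}(u'):u\ne u'\in\mathcal V_n\}$ is non-empty; and $\bigcup_{v\in\mathcal V_n}v^{\mathrm{ess}}$ is dense in $X$. The space of infinite paths starting at the root carries the topology generated by the cylinder sets of finite paths. **Statement.** For every $n\in\mathbb N$ the family $\mathcal R_n$ is a Markov partition. Moreover $\operatorname{h}(\varphi)$ is finite, and there are constants $\theta\in(0,\varepsilon_X]$ and $C,c>0$ such that: 1. $\operatorname{diam}(R)\le\lambda_X^{-n+1}\theta$ for all $n\in\mathbb N$ and $R\in\mathcal R_n$; 2. for every $n\in\mathbb N$, at most $(\#\mathcal R_1)^2$ different elements of $\mathcal R_n$ have a common point; 3. $\sup_n\max_{R\in\mathcal R_n}\#\{T\in\mathcal R_n:T\cap R\ne\varnothing\}<\infty$; 4. for every $\varepsilon\in(0,1)$ there is $n_0\in\mathbb N$ such that for all $n\ge n_0$ $$c\,e^{2(\operatorname{h}(\varphi)-\varepsilon)n}<\#\mathcal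 R_n<C\,e^{2(\operatorname{h}(\varphi)+\varepsilon)n};$$ 5. $(\mathcal R_n)_{n\ge0}$ is refining, its approximation graph $\Pi$ is essential, and $(\mathcal P_\Pi,\sigma_\Pi)=(\Sigma_M,\sigma_M)$ in the following sense. Let $M$ be the $\ell\times\ell$ matrix with $M_{i,j}=1$ if $\operatorname{int}(R_i)\cap\varphi^{-1}(\operatorname{int}(R_j))\ne\varnothing$ and $M_{i,j}=0$ otherwise, let $\Sigma_M=\{x\in\{1,\dots,\ell\}^{\mathbb Z}:M_{x_i,x_{i+1}}=1\ \text{for all } i\}$ with the product topology, and $\sigma_M(x)_i=x_{i+1}$. Let $\mathcal P_\Pi$ be the space of infinite paths $p=(p_n)_{n\ge0}$ of $\Pi$, and write $r(p_n)\in\mathcal R_{n+1}$ for the range of the edge $p_n$. Then there is a homeomorphism $\sigma_\Pi$ of $\mathcal P_\Pi$, the left shift, such that $q=\sigma_\Pi(p)$ if and only if there are $w_i\in\varphi^{-i}(\mathcal R_1)$, $i\in\mathbb Z$, with $r(p_n)=\bigcap_{|i|\le n}w_i$ and $r(q_n)=\bigcap_{|i|\le n}\varphi(w_{i+1})$ for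 all $n\ge0$; and there is a homeomorphism $\Phi:\Sigma_M\to\mathcal P_\Pi$ with $r(\Phi(x)_n)=\bigcap_{|i|\le n}\varphi^{-i}(R_{x_i})$ for all $x\in\Sigma_M$ and $n\ge0$, and $\Phi\circ\sigma_M=\sigma_\Pi\circ\Phi$. -/

import Mathlib

open Set Filter Topology
open scoped ENNReal

namespace SmaleMarkov

section Covers

variable {X : Type*}

/-- The cover `f⁻¹(𝒰) = {f⁻¹(U) : U ∈ 𝒰}`. -/
def pullback (f : X → X) (𝒰 : Set (Set X)) : Set (Set X) :=
  (fun U => f ⁻¹' U) '' 𝒰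

/-- The joint cover `⋁_{i ∈ I} 𝒰 i`: all sets `⋂_{i ∈ I} w i` with `w i ∈ 𝒰 i` for `i ∈ I`. -/
def joinCover {ι : Type*} (I : Set ι) (𝒰 : ι → Set (Set X)) : Set (Set X) :=
  {A | ∃ w : ι → Set X, (∀ i ∈ I, w i ∈ 𝒰 i) ∧ A = ⋂ i ∈ I, w i}

/-- The minimal cardinality of a (finite) subcover of `𝒰`. -/
noncomputable def minSubcover (𝒰 : Set (Set X)) : ℕ :=
  sInf {k | ∃ F : Finset (Set X), (F : Set (Set X)) ⊆ 𝒰 ∧ ⋃₀ (F : Set (Set X)) = univ ∧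
    F.card = k}

/-- The elements of `𝒰` that meet `Y`. -/
def neighbours (𝒰 : Set (Set X)) (Y : Set X) : Set (Set X) :=
  {U | U ∈ 𝒰 ∧ (U ∩ Y).Nonempty}

/-- The multiplicity of `𝒰`: the largest number of different elements of `𝒰` with a common point. -/
noncomputable def multiplicity (𝒰 : Set (Set X)) : ℕ∞ :=
  ⨆ (F : Finset (Set X)) (_ : (F : Set (Set X)) ⊆ 𝒰 ∧ (⋂₀ (F : Set (Set X))).Nonempty),
    (F.card : ℕ∞)

/-- The largest diameter of an element of `𝒰`. -/
noncomputable def maxDiam [MetricSpace X] (𝒰 : Set (Set X)) : ℝ≥0∞ :=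
  ⨆ U ∈ 𝒰, Metric.ediam U

end Covers

section Dynamics

variable {X : Type*} [TopologicalSpace X]

/-- Entropy of `f` relative to the cover `𝒰`: the growth rate of
`log N(⋁_{i=0}^{n-1} f⁻ⁱ(𝒰))`. For open covers of compact spaces the limit exists by
subadditivity, so that the upper limit is the limit. -/
noncomputable def coverEntropy (f : X → X) (𝒰 : Set (Set X)) : EReal :=
  limsup (fun n : ℕ =>
    ((Real.log (minSubcover (joinCover {i : ℕ | i < n} fun i => pullback f^[i] 𝒰)) / n : ℝ) : EReal))
    atTop

/-- Topological entropy: supremum over the finite open covers. -/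
noncomputable def topEntropy (f : X → X) : EReal :=
  ⨆ (𝒰 : Set (Set X)) (_ : 𝒰.Finite ∧ (∀ U ∈ 𝒰, IsOpen U) ∧ ⋃₀ 𝒰 = univ), coverEntropy f 𝒰

/-- Irreducibility (topological transitivity) with positive times. -/
def IsIrreducible (f : X → X) : Prop :=
  ∀ U V : Set X, IsOpen U → IsOpen V → U.Nonempty → V.Nonempty →
    ∃ n : ℕ, 1 ≤ n ∧ (f^[n] '' U ∩ V).Nonempty

end Dynamics

section Smale

variable {X : Type*} [MetricSpace X]

/-- The local stable set `X^s(x, r)` of a bracket map. -/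
def stableSet (br : X → X → X) (x : X) (r : ℝ) : Set X := {y | dist x y < r ∧ br x y = y}

/-- The local unstable set `X^u(x, r)` of a bracket map. -/
def unstableSet (br : X → X → X) (x : X) (r : ℝ) : Set X := {y | dist x y < r ∧ br y x = y}

/-- A Smale space structure on `(X, φ)`: an expansivity constant `eps`, a contraction constant
`lam` and a bracket map. The bracket is only meaningful for pairs at distance at most `eps`; each
axiom is required whenever both of its sides are defined. -/
structure SmaleSpace (φ : X ≃ₜ X) where
  eps : ℝ
  lam : ℝ
  bracket : X → X → X
  eps_pos : 0 < eps
  one_lt_lam : 1 < lam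
  continuousOn_bracket :
    ContinuousOn (fun p : X × X => bracket p.1 p.2) {p | dist p.1 p.2 ≤ eps}
  B1 : ∀ x, bracket x x = x
  B2 : ∀ x y z, dist y z ≤ eps → dist x (bracket y z) ≤ eps → dist x z ≤ eps →
    bracket x (bracket y z) = bracket x z
  B3 : ∀ x y z, dist x y ≤ eps → dist (bracket x y) z ≤ eps → dist x z ≤ eps →
    bracket (bracket x y) z = bracket x z
  B4 : ∀ x y, dist x y ≤ eps → dist (φ x) (φ y) ≤ eps →
    φ (bracket x y) = bracket (φ x) (φ y)
  C1 : ∀ (x : X) (r : ℝ), 0 < r → r ≤ eps →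
    ∀ y ∈ stableSet bracket x r, ∀ z ∈ stableSet bracket x r,
      dist (φ y) (φ z) ≤ lam⁻¹ * dist y z
  C2 : ∀ (x : X) (r : ℝ), 0 < r → r ≤ eps →
    ∀ y ∈ unstableSet bracket x r, ∀ z ∈ unstableSet bracket x r,
      dist (φ.symm y) (φ.symm z) ≤ lam⁻¹ * dist y z

variable {φ : X ≃ₜ X}

/-- `e` is admissible as the constant `ε'_X`. -/
def SmaleSpace.IsEps' (S : SmaleSpace φ) (e : ℝ) : Prop :=
  0 < e ∧ e ≤ S.eps / 2 ∧ ∀ x y, dist x y ≤ e →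
    dist x (S.bracket x y) < S.eps / 2 ∧ dist y (S.bracket x y) < S.eps / 2

/-- `e₂` is admissible as the constant `ε''_X`, for `ε'_X = e₁`. -/
def SmaleSpace.IsEps'' (S : SmaleSpace φ) (e₁ e₂ : ℝ) : Prop :=
  0 < e₂ ∧ e₂ < e₁ / 12 ∧ ∀ x y, dist x y ≤ e₂ →
    (∀ i : ℤ, |i| ≤ 2 → dist ((φ ^ i) x) ((φ ^ i) y) ≤ e₁ / 2) ∧
    dist (S.bracket x y) y ≤ e₁ / 4 ∧ dist (S.bracket x y) x ≤ e₁ / 4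

/-- Rectangles; `e₁` is the constant `ε'_X`. -/
def SmaleSpace.IsRectangle (S : SmaleSpace φ) (e₁ : ℝ) (R : Set X) : Prop :=
  R.Nonempty ∧ Metric.ediam R ≤ ENNReal.ofReal e₁ ∧ ∀ x ∈ R, ∀ y ∈ R, S.bracket x y ∈ R

/-- Proper rectangles. -/
def SmaleSpace.IsProperRectangle (S : SmaleSpace φ) (e₁ : ℝ) (R : Set X) : Prop :=
  S.IsRectangle e₁ R ∧ IsClosed R ∧ R = closure (interior R)

/-- `X^s(x, R) = X^s(x, 2ε'_X) ∩ R`. -/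
def SmaleSpace.stableIn (S : SmaleSpace φ) (e₁ : ℝ) (x : X) (R : Set X) : Set X :=
  stableSet S.bracket x (2 * e₁) ∩ R

/-- `X^u(x, R) = X^u(x, 2ε'_X) ∩ R`. -/
def SmaleSpace.unstableIn (S : SmaleSpace φ) (e₁ : ℝ) (x : X) (R : Set X) : Set X :=
  unstableSet S.bracket x (2 * e₁) ∩ R

/-- Markov partitions; `e₁` is the constant `ε'_X`. -/
structure SmaleSpace.IsMarkovPartition (S : SmaleSpace φ) (e₁ : ℝ) (𝓡 : Set (Set X)) :
    Prop where
  finite : 𝓡.Finite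
  cover : ⋃₀ 𝓡 = univ
  proper : ∀ R ∈ 𝓡, S.IsProperRectangle e₁ R
  disjoint : ∀ R ∈ 𝓡, ∀ T ∈ 𝓡, R ≠ T → interior R ∩ interior T = ∅
  unstable : ∀ R ∈ 𝓡, ∀ T ∈ 𝓡, ∀ x ∈ interior R ∩ φ ⁻¹' interior T,
    S.unstableIn e₁ (φ x) T ⊆ φ '' S.unstableIn e₁ x R
  stable : ∀ R ∈ 𝓡, ∀ T ∈ 𝓡, ∀ x ∈ interior R ∩ φ ⁻¹' interior T,
    φ '' S.stableIn e₁ x R ⊆ S.stableIn e₁ (φ x) T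

/-- The sequence `𝓡₀ = {X}` and, for `m = n + 1 ≥ 1`, `𝓡ₘ` is the set of all
`R ∈ ⋁_{i=1-m}^{m-1} φ⁻ⁱ(𝓡₁)` with non-empty interior. -/
def refinement (φ : X ≃ₜ X) (𝓡₁ : Set (Set X)) : ℕ → Set (Set X)
  | 0 => {univ}
  | n + 1 => {A | A ∈ joinCover (Icc (-(n : ℤ)) n) (fun i => pullback ⇑(φ ^ i) 𝓡₁) ∧
      (interior A).Nonempty}

end Smale

section Graphs

variable {X : Type*}

/-- The edges of the approximation graph of `𝒱` with source in `𝒱 n` and range in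
`𝒱 (n + 1)`. -/
@[ext]
structure Edge (𝒱 : ℕ → Set (Set X)) (n : ℕ) where
  src : Set X
  rng : Set X
  src_mem : src ∈ 𝒱 n
  rng_mem : rng ∈ 𝒱 (n + 1)
  rng_subset_src : rng ⊆ src

/-- The infinite paths of the approximation graph, starting at the root. -/
@[ext]
structure PathSpace (𝒱 : ℕ → Set (Set X)) where
  edge : ∀ n, Edge 𝒱 n
  src_succ : ∀ n, (edge (n + 1)).src = (edge n).rng

/-- The topology on the path space generated by the cylinder sets of finite paths. -/
instance pathTopology (𝒱 : ℕ → Set (Set X)) : TopologicalSpace (PathSpace 𝒱) :=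
  TopologicalSpace.generateFrom
    {C | ∃ (l : ℕ) (μ : ∀ i : Fin (l + 1), Edge 𝒱 (i : ℕ)),
      (∀ i : Fin l, (μ i.succ).src = (μ i.castSucc).rng) ∧
      C = {p | ∀ i : Fin (l + 1), p.edge i = μ i}}

variable [MetricSpace X]

/-- Refining sequences of finite covers, all open or all closed with non-empty interiors. -/
structure IsRefining (𝒱 : ℕ → Set (Set X)) : Prop where
  zero : 𝒱 0 = {univ}
  finite : ∀ n, (𝒱 n).Finite
  cover : ∀ n, ⋃₀ 𝒱 n = univ
  open_or_closed : (∀ n, ∀ v ∈ 𝒱 n, IsOpen v) ∨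
    (∀ n, ∀ v ∈ 𝒱 n, IsClosed v ∧ (interior v).Nonempty)
  refines : ∀ n, ∀ w ∈ 𝒱 (n + 1), ∃ v ∈ 𝒱 n, w ⊆ v
  diam_tendsto : Tendsto (fun n => maxDiam (𝒱 n)) atTop (𝓝 0)

/-- `𝒱` is a refining sequence whose graph has no sinks and has the root as its only source. -/
structure IsApproximationGraph (𝒱 : ℕ → Set (Set X)) : Prop where
  refining : IsRefining 𝒱
  no_sinks : ∀ n, ∀ v ∈ 𝒱 n, ∃ e : Edge 𝒱 n, e.src = v
  no_sources : ∀ n, ∀ v ∈ 𝒱 (n + 1), ∃ e : Edge 𝒱 n, e.rng = v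

/-- The overlapping set of a cover. -/
def overlaps (𝒰 : Set (Set X)) : Set (Set X) :=
  {Y | ∃ v ∈ 𝒰, ∃ w ∈ 𝒰, v ≠ w ∧ Y = closure v ∩ closure w}

/-- The essential part of an element `v` of a cover. -/
def essPart (𝒰 : Set (Set X)) (v : Set X) : Set X :=
  interior v \ ⋃₀ overlaps 𝒰

/-- Regular approximation graphs. -/
structure IsRegular (𝒱 : ℕ → Set (Set X)) : Prop where
  graph : IsApproximationGraph 𝒱
  E1 : ∀ n, 1 ≤ n → ∀ v ∈ 𝒱 n, v = ⋃₀ {w | w ∈ 𝒱 (n + 1) ∧ w ⊆ v}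
  E2 : ∀ n, 1 ≤ n → ∀ v ∈ 𝒱 n, (essPart (𝒱 n) v).Nonempty

/-- Essential approximation graphs. -/
structure IsEssential (𝒱 : ℕ → Set (Set X)) : Prop where
  regular : IsRegular 𝒱
  closed : ∀ n, ∀ v ∈ 𝒱 n, IsClosed v
  dense : ∀ n, 1 ≤ n → Dense (⋃ v ∈ 𝒱 n, essPart (𝒱 n) v)

/-- `q` is the image of the path `p` under the left shift: there are `w i ∈ φ⁻ⁱ(𝒱₁)`, `i ∈ ℤ`,
such that the `n`-th edge of `p` ends at the set of the word `w₋ₙ … wₙ`, that is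
`⋂_{|i| ≤ n} w i`, and the `n`-th edge of `q` ends at the set of the word
`φ(w₋ₙ₊₁) … φ(wₙ₊₁)`. -/
def IsShift (φ : X ≃ₜ X) {𝒱 : ℕ → Set (Set X)} (p q : PathSpace 𝒱) : Prop :=
  ∃ w : ℤ → Set X, (∀ i, w i ∈ pullback ⇑(φ ^ i) (𝒱 1)) ∧
    (∀ n : ℕ, (p.edge n).rng = ⋂ i ∈ Icc (-(n : ℤ)) n, w i) ∧
    (∀ n : ℕ, (q.edge n).rng = ⋂ i ∈ Icc (-(n : ℤ)) n, φ '' w (i + 1))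

end Graphs

section MarkovChains

open Classical in
/-- The transition matrix of `R₁, …, R_l`. -/
noncomputable def transitionMatrix {X : Type*} [TopologicalSpace X] (φ : X ≃ₜ X) {l : ℕ}
    (R : Fin l → Set X) : Matrix (Fin l) (Fin l) ℕ :=
  Matrix.of fun i j => if (interior (R i) ∩ φ ⁻¹' interior (R j)).Nonempty then 1 else 0

/-- The space `Σ_M` of allowable sequences, with the topology induced by the product topology
on `{1, …, l}^ℤ`. -/
abbrev MarkovChain {l : ℕ} (M : Matrix (Fin l) (Fin l) ℕ) : Type :=
  {x : ℤ → Fin l // ∀ i, M (x i) (x (i + 1)) = 1}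

/-- The shift map `σ_M`. -/
def markovShift {l : ℕ} (M : Matrix (Fin l) (Fin l) ℕ) (x : MarkovChain M) : MarkovChain M :=
  ⟨fun i => x.1 (i + 1), fun i => x.2 (i + 1)⟩

end MarkovChains

end SmaleMarkov

/-! The members of the (n+1)-st refinement are the cylinders with non-empty interior: sets of points
whose itinerary through the rectangles follows a fixed word at the times from -n to n
(`refinement_succ`). Everything is therefore a statement about cylinders of words.

The bracket [x, y] combines the future of x with the past of y, and the Markov property makes this
literal for words: bracketing a point of a cylinder with a point of the first or last rectangle does
not leave the cylinder (`mem_cylinder_of_stable`, `mem_cylinder_of_unstable`). The bracket also maps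
products of open sets of nearby points to open sets (`isOpen_image2_bracket`). Together these facts
give the three main lemmas: allowed words have cylinders with non-empty interior
(`interior_cylinder_nonempty`), such cylinders are closures of their interiors
(`cylinder_subset_closure`), and a word is determined by its two end letters among words with nearby
itineraries (`word_unique`).

The last lemma gives the bound l² for multiplicities and neighbours, uniformly in the length. It
also shows that an element of a join of small balls meets at most l² cylinders, so that the entropy
is at least the growth rate of the number of words. The reverse inequality holds because long
cylinders are small, by contraction along both directions of the bracket. The growth rate exists by
subadditivity, and the factor 2 in the exponent comes from words of length 2n - 1. Disjointness of
interiors makes the letters of a cylinder unique, so a path of nested cylinders is the same as a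
two-sided allowed sequence. -/

namespace SmaleMarkov

/-! ### Integer powers of a homeomorphism -/

section Iterates

variable {X : Type*} [TopologicalSpace X]

theorem zpow_add_one_apply (φ : X ≃ₜ X) (i : ℤ) (x : X) : (φ ^ (i + 1)) x = φ ((φ ^ i) x) := by
  rw [add_comm, zpow_add, zpow_one]; rfl

theorem zpow_add_apply (φ : X ≃ₜ X) (i j : ℤ) (x : X) :
    (φ ^ (i + j)) x = (φ ^ i) ((φ ^ j) x) := by
  rw [zpow_add]; rfl

theorem zpow_zero_apply (φ : X ≃ₜ X) (x : X) : (φ ^ (0 : ℤ)) x = x := by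
  rw [zpow_zero]; rfl

theorem zpow_natCast_apply (φ : X ≃ₜ X) (n : ℕ) (x : X) : (φ ^ (n : ℤ)) x = φ^[n] x := by
  induction n with
  | zero => simp
  | succ n ih => rw [Nat.cast_succ, zpow_add_one_apply, ih, Function.iterate_succ_apply']

end Iterates

/-! ### The bracket: associativity, openness, compatibility with the dynamics -/

section Brackets

variable {X : Type*} [MetricSpace X] {φ : X ≃ₜ X} {S : SmaleSpace φ} {e₁ : ℝ}

namespace SmaleSpace.IsEps'

theorem le_half (h : S.IsEps' e₁) : e₁ ≤ S.eps / 2 := h.2.1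

theorem dist_left (h : S.IsEps' e₁) {x y : X} (hxy : dist x y ≤ e₁) :
    dist x (S.bracket x y) < S.eps / 2 := (h.2.2 x y hxy).1

theorem dist_right (h : S.IsEps' e₁) {x y : X} (hxy : dist x y ≤ e₁) :
    dist y (S.bracket x y) < S.eps / 2 := (h.2.2 x y hxy).2

/-- The inner bracket is within `eps / 2` of z, and x is within `e₁ ≤ eps / 2` of z, so the pairs in
B2 are all at distance at most `eps`. -/
theorem bracket_bracket_right (h : S.IsEps' e₁) {x y z : X} (hxz : dist x z ≤ e₁)
    (hyz : dist y z ≤ e₁) : S.bracket x (S.bracket y z) = S.bracket x z := by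
  have h1 := h.dist_right hyz
  have h2 := h.le_half
  have h3 := S.eps_pos
  have h4 := dist_triangle x z (S.bracket y z)
  exact S.B2 x y z (by linarith) (by linarith) (by linarith)

theorem bracket_bracket_left (h : S.IsEps' e₁) {x y z : X} (hxy : dist x y ≤ e₁)
    (hxz : dist x z ≤ e₁) : S.bracket (S.bracket x y) z = S.bracket x z := by
  have h1 := h.dist_left hxy
  have h2 := h.le_half
  have h3 := S.eps_pos
  have h4 := dist_triangle (S.bracket x y) x z
  rw [dist_comm _ x] at h4
  exact S.B3 x y z (by linarith) (by linarith) (by linarith)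

theorem dist_self_le (h : S.IsEps' e₁) (x : X) : dist x x ≤ e₁ := by
  rw [dist_self]; exact h.1.le

end SmaleSpace.IsEps'

theorem SmaleSpace.continuousAt_bracket (S : SmaleSpace φ) {x y : X} (h : dist x y < S.eps) :
    ContinuousAt (fun p : X × X => S.bracket p.1 p.2) (x, y) :=
  S.continuousOn_bracket.continuousAt <|
    mem_of_superset ((isOpen_lt continuous_dist continuous_const).mem_nhds h)
      fun p (hp : dist p.1 p.2 < S.eps) => mem_ofPred.2 hp.le

/-- The bracket maps a product of open sets of nearby points to an open set. -/
theorem SmaleSpace.IsEps'.isOpen_image2_bracket (h : S.IsEps' e₁) {U V : Set X} (hU : IsOpen U)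
    (hV : IsOpen V) (hUV : ∀ u ∈ U, ∀ v ∈ V, dist u v ≤ e₁) : IsOpen (image2 S.bracket U V) := by
  rw [isOpen_iff_mem_nhds]
  rintro w ⟨u, hu, v, hv, rfl⟩
  have huv := hUV u hu v hv
  have h2 := h.le_half
  have h3 := S.eps_pos
  set w := S.bracket u v with hw
  have hwu : dist w u < S.eps := by rw [dist_comm]; linarith [h.dist_left huv]
  have hvw : dist v w < S.eps := by linarith [h.dist_right huv]
  -- Near w, the map w' ↦ ([w', u], [v, w']) is a continuous right inverse of the bracket; it takes
  -- w to (u, v).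
  have e1 : S.bracket w u = u := by
    rw [hw, h.bracket_bracket_left huv (h.dist_self_le u), S.B1]
  have e2 : S.bracket v w = v := by
    rw [hw, h.bracket_bracket_right (h.dist_self_le v) huv, S.B1]
  have c1 : Tendsto (fun w' => S.bracket w' u) (𝓝 w) (𝓝 u) := by
    have := (S.continuousAt_bracket hwu).comp (f := fun w' => (w', u))
      (continuous_id.prodMk continuous_const).continuousAt
    simpa [ContinuousAt, Function.comp_def, e1] using this
  have c2 : Tendsto (fun w' => S.bracket v w') (𝓝 w) (𝓝 v) := by
    have := (S.continuousAt_bracket hvw).comp (f := fun w' => (v, w'))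
      (continuous_const.prodMk continuous_id).continuousAt
    simpa [ContinuousAt, Function.comp_def, e2] using this
  have c3 : ∀ᶠ w' in 𝓝 w, dist w' u < S.eps :=
    (continuous_id.dist continuous_const).tendsto w |>.eventually (gt_mem_nhds hwu)
  have c4 : ∀ᶠ w' in 𝓝 w, dist v w' < S.eps :=
    (continuous_const.dist continuous_id).tendsto w |>.eventually (gt_mem_nhds hvw)
  have c5 : ∀ᶠ w' in 𝓝 w, dist w' (S.bracket v w') < S.eps :=
    (tendsto_id.dist c2).eventually (gt_mem_nhds (by rw [dist_comm]; exact hvw))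
  filter_upwards [c1 (hU.mem_nhds hu), c2 (hV.mem_nhds hv), c3, c4, c5] with w' h1 h2' h3' h4 h5
  refine ⟨_, h1, _, h2', ?_⟩
  have h6 := hUV _ h1 _ h2'
  -- [[w', u], [v, w']] = [w', [v, w']] = [w', w'] = w'.
  rw [S.B3 _ _ _ h3'.le (by linarith) h5.le, S.B2 _ _ _ h4.le h5.le (by simpa using h3.le), S.B1]

/-- The bracket commutes with the powers of `φ` as long as the orbits stay close. -/
theorem SmaleSpace.zpow_bracket (S : SmaleSpace φ) {y z : X} {p q : ℤ} (hp : p ≤ 0) (hq : 0 ≤ q)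
    (h : ∀ i ∈ Icc p q, dist ((φ ^ i) y) ((φ ^ i) z) ≤ S.eps) :
    ∀ i ∈ Icc p q, (φ ^ i) (S.bracket y z) = S.bracket ((φ ^ i) y) ((φ ^ i) z) := by
  have key : ∀ i, p ≤ i → i < q →
      φ (S.bracket ((φ ^ i) y) ((φ ^ i) z)) = S.bracket ((φ ^ (i + 1)) y) ((φ ^ (i + 1)) z) := by
    intro i h1 h2
    have := h (i + 1) ⟨by omega, by omega⟩
    rw [zpow_add_one_apply, zpow_add_one_apply] at this ⊢
    exact S.B4 _ _ (h i ⟨h1, h2.le⟩) this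
  have up : ∀ i, 0 ≤ i → i ≤ q →
      (φ ^ i) (S.bracket y z) = S.bracket ((φ ^ i) y) ((φ ^ i) z) := by
    intro i hi
    induction i, hi using Int.leInduction with
    | base => intro _; simp only [zpow_zero_apply]
    | succ n hn ih => intro hle; rw [zpow_add_one_apply, ih (by omega), key n (by omega) (by omega)]
  have down : ∀ i, i ≤ 0 → p ≤ i →
      (φ ^ i) (S.bracket y z) = S.bracket ((φ ^ i) y) ((φ ^ i) z) := by
    intro i hi
    induction i, hi using Int.leInductionDown with
    | base => intro _; simp only [zpow_zero_apply]
    | pred n hn ih =>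
      intro hle
      apply φ.injective
      rw [key _ hle (by omega), ← zpow_add_one_apply, sub_add_cancel, ih (by omega)]
  intro i hi
  rcases le_total 0 i with h0 | h0
  · exact up i h0 hi.2
  · exact down i h0 hi.1

end Brackets

/-! ### Cylinders of words -/

section Cylinders

variable {X : Type*} {l : ℕ}

/-- The points whose itinerary with respect to `R` follows the word `a` from time `p` to
time `q`. -/
def cylinder [TopologicalSpace X] (φ : X ≃ₜ X) (R : Fin l → Set X) (a : ℤ → Fin l) (p q : ℤ) :
    Set X :=
  ⋂ i ∈ Icc p q, (φ ^ i) ⁻¹' R (a i)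

/-- The cylinders between the times `p` and `q` that have non-empty interior. -/
def cylinders [TopologicalSpace X] (φ : X ≃ₜ X) (R : Fin l → Set X) (p q : ℤ) : Set (Set X) :=
  {A | ∃ a, A = cylinder φ R a p q ∧ (interior A).Nonempty}

/-- The transition from `j` to `k` is allowed. -/
def Transition [TopologicalSpace X] (φ : X ≃ₜ X) (R : Fin l → Set X) (j k : Fin l) : Prop :=
  (interior (R j) ∩ φ ⁻¹' interior (R k)).Nonempty

section Topological

variable [TopologicalSpace X] {φ : X ≃ₜ X} {R : Fin l → Set X} {a b : ℤ → Fin l} {p q p' q' : ℤ}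

theorem mem_cylinder {x : X} :
    x ∈ cylinder φ R a p q ↔ ∀ i ∈ Icc p q, (φ ^ i) x ∈ R (a i) := by
  simp [cylinder]

/-- The intersection is finite and powers of `φ` are homeomorphisms, so membership in the interior
can be tested letter by letter. -/
theorem interior_cylinder :
    interior (cylinder φ R a p q) = ⋂ i ∈ Icc p q, (φ ^ i) ⁻¹' interior (R (a i)) := by
  rw [cylinder, (finite_Icc p q).interior_biInter]
  simp only [Homeomorph.preimage_interior]

theorem mem_interior_cylinder {x : X} :
    x ∈ interior (cylinder φ R a p q) ↔ ∀ i ∈ Icc p q, (φ ^ i) x ∈ interior (R (a i)) := by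
  simp [interior_cylinder]

theorem cylinder_anti (hp : p' ≤ p) (hq : q ≤ q') :
    cylinder φ R a p' q' ⊆ cylinder φ R a p q :=
  biInter_subset_biInter_left (Icc_subset_Icc hp hq)

theorem cylinder_congr (h : ∀ i ∈ Icc p q, a i = b i) :
    cylinder φ R a p q = cylinder φ R b p q :=
  iInter₂_congr fun i hi => by rw [h i hi]

theorem transition_of_mem_interior_cylinder {x : X} (hx : x ∈ interior (cylinder φ R a p q)) :
    ∀ i, p ≤ i → i < q → Transition φ R (a i) (a (i + 1)) := by
  intro i h1 h2
  rw [mem_interior_cylinder] at hx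
  refine ⟨(φ ^ i) x, hx i ⟨h1, h2.le⟩, ?_⟩
  have := hx (i + 1) ⟨by omega, by omega⟩
  rwa [zpow_add_one_apply] at this

end Topological

end Cylinders

/-! ### The Markov property for words -/

section Markov

variable {X : Type*} [MetricSpace X] {φ : X ≃ₜ X} {S : SmaleSpace φ} {e₁ e₂ : ℝ} {l : ℕ}
  {R : Fin l → Set X}

/-- A Markov partition whose members have diameter at most `ε''_X`. -/
structure IsSmallPartition (S : SmaleSpace φ) (e₁ e₂ : ℝ) (R : Fin l → Set X) : Prop where
  eps' : S.IsEps' e₁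
  eps'' : S.IsEps'' e₁ e₂
  inj : Function.Injective R
  markov : S.IsMarkovPartition e₁ (range R)
  dist_le : ∀ j, ∀ x ∈ R j, ∀ y ∈ R j, dist x y ≤ e₂

namespace IsSmallPartition

theorem le_eps' (P : IsSmallPartition S e₁ e₂ R) : 12 * e₂ ≤ e₁ := by
  linarith [P.eps''.2.1]

theorem close (P : IsSmallPartition S e₁ e₂ R) {j : Fin l} {x y : X} (hx : x ∈ R j)
    (hy : y ∈ R j) : dist x y ≤ e₁ := by
  linarith [P.dist_le j x hx y hy, P.le_eps', P.eps''.1]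

theorem bracket_mem (P : IsSmallPartition S e₁ e₂ R) {j : Fin l} {x y : X} (hx : x ∈ R j)
    (hy : y ∈ R j) : S.bracket x y ∈ R j :=
  (P.markov.proper _ (mem_range_self j)).1.2.2 x hx y hy

theorem isClosed (P : IsSmallPartition S e₁ e₂ R) (j : Fin l) : IsClosed (R j) :=
  (P.markov.proper _ (mem_range_self j)).2.1

theorem eq_closure (P : IsSmallPartition S e₁ e₂ R) (j : Fin l) : R j = closure (interior (R j)) :=
  (P.markov.proper _ (mem_range_self j)).2.2

theorem eq_of_mem_interior (P : IsSmallPartition S e₁ e₂ R) {j k : Fin l} {x : X}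
    (hj : x ∈ interior (R j)) (hk : x ∈ interior (R k)) : j = k := by
  by_contra hne
  have := P.markov.disjoint _ (mem_range_self j) _ (mem_range_self k) (P.inj.ne hne)
  exact (this ▸ mem_inter hj hk : x ∈ (∅ : Set X))

theorem e₁_le_eps (P : IsSmallPartition S e₁ e₂ R) : e₁ ≤ S.eps := by
  linarith [P.eps'.le_half, S.eps_pos]

/-- The stable half of the Markov property, without interiors. -/
theorem map_bracket_mem (P : IsSmallPartition S e₁ e₂ R) {j k : Fin l} (h : Transition φ R j k)
    {x y : X} (hx : x ∈ R j) (hy : y ∈ R j) (hxk : φ x ∈ R k) : φ (S.bracket x y) ∈ R k := by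
  obtain ⟨x₀, hj, hk⟩ := h
  have hj' := interior_subset hj
  -- The partition axiom applies only at an interior point, such as x₀. It controls [x₀, y], and
  -- this suffices because [x, y] = [x, [x₀, y]].
  have hz := P.bracket_mem hj' hy
  have h1 : φ (S.bracket x₀ y) ∈ R k :=
    (P.markov.stable _ (mem_range_self j) _ (mem_range_self k) x₀ ⟨hj, hk⟩
      (mem_image_of_mem φ ⟨⟨by linarith [P.close hj' hz, P.eps'.1],
        P.eps'.bracket_bracket_right (P.close hj' hy) (P.close hj' hy)⟩, hz⟩)).2
  rw [← P.eps'.bracket_bracket_right (P.close hx hy) (P.close hj' hy),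
    S.B4 _ _ ((P.close hx hz).trans P.e₁_le_eps) ((P.close hxk h1).trans P.e₁_le_eps)]
  exact P.bracket_mem hxk h1

/-- The unstable half of the Markov property, without interiors. -/
theorem symm_bracket_mem (P : IsSmallPartition S e₁ e₂ R) {j k : Fin l} (h : Transition φ R j k)
    {x y : X} (hx : x ∈ R k) (hy : φ y ∈ R k) (hyj : y ∈ R j) :
    ∃ z ∈ R j, φ z = S.bracket x (φ y) := by
  obtain ⟨x₀, hj, hk⟩ := h
  have hk' : φ x₀ ∈ R k := interior_subset hk
  have hz := P.bracket_mem hx hk'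
  obtain ⟨z, ⟨-, hzj⟩, hzx⟩ := P.markov.unstable _ (mem_range_self j) _ (mem_range_self k) x₀
    ⟨hj, hk⟩ ⟨⟨by linarith [P.close hk' hz, P.eps'.1],
        P.eps'.bracket_bracket_left (P.close hx hk') (P.close hx hk')⟩, hz⟩
  -- Here φ z = [x, φ x₀], so φ [z, y] = [[x, φ x₀], φ y] = [x, φ y].
  refine ⟨S.bracket z y, P.bracket_mem hzj hyj, ?_⟩
  rw [S.B4 _ _ ((P.close hzj hyj).trans P.e₁_le_eps)
    ((P.close (hzx ▸ hz) hy).trans P.e₁_le_eps), hzx,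
    P.eps'.bracket_bracket_left (P.close hx hk') (P.close hx hy)]

variable {a b : ℤ → Fin l} {p q : ℤ}

/-- Moving along the stable direction from a point of a cylinder. -/
theorem mem_cylinder_of_stable (P : IsSmallPartition S e₁ e₂ R)
    (ha : ∀ i, p ≤ i → i < q → Transition φ R (a i) (a (i + 1))) {t w u : X}
    (ht : t ∈ cylinder φ R a p q) (hpq : p ≤ q) (hu : u ∈ R (a p))
    (hw : (φ ^ p) w = S.bracket ((φ ^ p) t) u) : w ∈ cylinder φ R a p q := by
  rw [mem_cylinder] at ht ⊢
  have htp := ht p ⟨le_rfl, hpq⟩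
  -- The second conjunct keeps the orbit of w on the local stable sets of the orbit of t, so that
  -- `map_bracket_mem` can be applied at every step forward.
  have key : ∀ i, p ≤ i → i ≤ q → (φ ^ i) w ∈ R (a i) ∧
      S.bracket ((φ ^ i) t) ((φ ^ i) w) = (φ ^ i) w := by
    intro i hi
    induction i, hi using Int.leInduction with
    | base =>
      intro _
      rw [hw]
      exact ⟨P.bracket_mem htp hu, P.eps'.bracket_bracket_right (P.close htp hu) (P.close htp hu)⟩
    | succ n hn ih =>
      intro hle
      obtain ⟨h1, h2⟩ := ih (by omega)
      have h3 := ht n ⟨hn, by omega⟩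
      have h4 := ht (n + 1) ⟨by omega, by omega⟩
      have h5 := P.map_bracket_mem (ha n hn (by omega)) h3 h1 (by rwa [zpow_add_one_apply] at h4)
      rw [h2, ← zpow_add_one_apply] at h5
      refine ⟨h5, ?_⟩
      rw [zpow_add_one_apply, zpow_add_one_apply] at *
      rw [← S.B4 _ _ ((P.close h3 h1).trans P.e₁_le_eps) ((P.close h4 h5).trans P.e₁_le_eps), h2]
  exact fun i hi => (key i hi.1 hi.2).1

/-- Moving along the unstable direction from a point of a cylinder. -/
theorem mem_cylinder_of_unstable (P : IsSmallPartition S e₁ e₂ R)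
    (ha : ∀ i, p ≤ i → i < q → Transition φ R (a i) (a (i + 1))) {t w v : X}
    (ht : t ∈ cylinder φ R a p q) (hpq : p ≤ q) (hv : v ∈ R (a q))
    (hw : (φ ^ q) w = S.bracket v ((φ ^ q) t)) : w ∈ cylinder φ R a p q := by
  rw [mem_cylinder] at ht ⊢
  have htq := ht q ⟨hpq, le_rfl⟩
  -- Backward induction from q; the second conjunct identifies the point supplied by
  -- `symm_bracket_mem` with the actual preimage.
  have key : ∀ i, i ≤ q → p ≤ i → (φ ^ i) w ∈ R (a i) ∧
      S.bracket ((φ ^ i) w) ((φ ^ i) t) = (φ ^ i) w := by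
    intro i hi
    induction i, hi using Int.leInductionDown with
    | base =>
      intro _
      rw [hw]
      exact ⟨P.bracket_mem hv htq, P.eps'.bracket_bracket_left (P.close hv htq) (P.close hv htq)⟩
    | pred n hn ih =>
      intro hle
      obtain ⟨m, rfl⟩ : ∃ m, n = m + 1 := ⟨n - 1, by omega⟩
      rw [add_sub_cancel_right] at hle ⊢
      obtain ⟨h1, h2⟩ := ih (by omega)
      have h3 := ht m ⟨hle, by omega⟩
      have h4 := ht (m + 1) ⟨by omega, by omega⟩
      rw [zpow_add_one_apply] at h1 h2 h4
      rw [zpow_add_one_apply] at h2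
      obtain ⟨z, hz, hzw⟩ := P.symm_bracket_mem (ha m hle (by omega)) h1 h4 h3
      obtain rfl : z = (φ ^ m) w := φ.injective (hzw.trans h2)
      refine ⟨hz, φ.injective ?_⟩
      rw [S.B4 _ _ ((P.close hz h3).trans P.e₁_le_eps) ((P.close h1 h4).trans P.e₁_le_eps), h2]
  exact fun i hi => (key i hi.2 hi.1).1

/-- Words with the same first and last letters and with nearby itineraries are equal. -/
theorem word_unique (P : IsSmallPartition S e₁ e₂ R) (hp : p ≤ 0) (hq : 0 ≤ q)
    (ha : (interior (cylinder φ R a p q)).Nonempty) (hb : (interior (cylinder φ R b p q)).Nonempty)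
    (hap : a p = b p) (haq : a q = b q)
    (hab : ∀ i ∈ Icc p q, ∀ y ∈ R (a i), ∀ z ∈ R (b i), dist y z ≤ e₁) :
    ∀ i ∈ Icc p q, a i = b i := by
  have hclose : ∀ y ∈ cylinder φ R a p q, ∀ z ∈ cylinder φ R b p q, ∀ i ∈ Icc p q,
      dist ((φ ^ i) y) ((φ ^ i) z) ≤ e₁ := fun y hy z hz i hi =>
    hab i hi _ (mem_cylinder.1 hy i hi) _ (mem_cylinder.1 hz i hi)
  have hopen : IsOpen (image2 S.bracket (interior (cylinder φ R a p q))
      (interior (cylinder φ R b p q))) :=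
    P.eps'.isOpen_image2_bracket isOpen_interior isOpen_interior fun y hy z hz => by
      simpa using hclose y (interior_subset hy) z (interior_subset hz) 0 ⟨hp, hq⟩
  -- [y, z] follows both words. It follows a because at time p the point z is in the first rectangle
  -- of a, and it follows b because at time q the point y is in the last rectangle of b. Such
  -- brackets fill an open set, whose points are interior to both cylinders.
  have hsub : image2 S.bracket (interior (cylinder φ R a p q)) (interior (cylinder φ R b p q)) ⊆
      cylinder φ R a p q ∩ cylinder φ R b p q := by
    rintro _ ⟨y, hy, z, hz, rfl⟩
    have hy' := interior_subset hy
    have hz' := interior_subset hz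
    have heq := S.zpow_bracket hp hq fun i hi => (hclose y hy' z hz' i hi).trans P.e₁_le_eps
    exact ⟨P.mem_cylinder_of_stable (transition_of_mem_interior_cylinder hy) hy' (hp.trans hq)
        (hap ▸ mem_cylinder.1 hz' p ⟨le_rfl, hp.trans hq⟩) (heq p ⟨le_rfl, hp.trans hq⟩),
      P.mem_cylinder_of_unstable (transition_of_mem_interior_cylinder hz) hz' (hp.trans hq)
        (haq ▸ mem_cylinder.1 hy' q ⟨hp.trans hq, le_rfl⟩) (heq q ⟨hp.trans hq, le_rfl⟩)⟩
  obtain ⟨w, hw⟩ := ha.image2 hb (f := S.bracket)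
  have hw' := interior_maximal hsub hopen hw
  rw [interior_inter] at hw'
  exact fun i hi => P.eq_of_mem_interior (mem_interior_cylinder.1 hw'.1 i hi)
    (mem_interior_cylinder.1 hw'.2 i hi)

/-- Allowed words have cylinders with non-empty interior. -/
theorem interior_cylinder_nonempty (P : IsSmallPartition S e₁ e₂ R) (hpq : p ≤ q)
    (ha : ∀ i, p ≤ i → i < q → Transition φ R (a i) (a (i + 1))) :
    (interior (cylinder φ R a p q)).Nonempty := by
  induction q, hpq using Int.leInduction with
  | base =>
    obtain ⟨x, hx⟩ : (interior (R (a p))).Nonempty := by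
      rw [← closure_nonempty_iff, ← P.eq_closure]
      exact (P.markov.proper _ (mem_range_self _)).1.1
    refine ⟨(φ ^ p).symm x, mem_interior_cylinder.2 fun i hi => ?_⟩
    obtain rfl : i = p := le_antisymm hi.2 hi.1
    simpa using hx
  | succ q hpq ih =>
    have hb := ih fun i h1 h2 => ha i h1 (by omega)
    set U := interior (cylinder φ R a p q)
    set V := interior (R (a q)) ∩ φ ⁻¹' interior (R (a (q + 1)))
    have hV : V.Nonempty := ha q hpq (by omega)
    have hUR : ∀ x ∈ U, (φ ^ q) x ∈ R (a q) := fun x hx =>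
      mem_cylinder.1 (interior_subset hx) q ⟨hpq, le_rfl⟩
    -- At time q, glue the past of a point x of U to the future of a point v of V: [v, φ^q x] keeps
    -- the word up to q and enters the next rectangle with v.
    have hopen : IsOpen ((φ ^ q) ⁻¹' image2 S.bracket V ((φ ^ q) '' U)) := by
      refine (P.eps'.isOpen_image2_bracket
        (isOpen_interior.inter (isOpen_interior.preimage φ.continuous))
        ((φ ^ q).isOpenMap _ isOpen_interior) ?_).preimage (φ ^ q).continuous
      rintro v hv _ ⟨x, hx, rfl⟩
      exact P.close (interior_subset hv.1) (hUR x hx)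
    have hne : ((φ ^ q) ⁻¹' image2 S.bracket V ((φ ^ q) '' U)).Nonempty :=
      (hV.image2 (hb.image _)).preimage (φ ^ q).surjective
    refine hne.mono (interior_maximal ?_ hopen)
    rintro w ⟨v, hv, _, ⟨x, hx, rfl⟩, hw⟩
    have hvq : v ∈ R (a q) := interior_subset hv.1
    have h1 := mem_cylinder.1 <| P.mem_cylinder_of_unstable (fun i h1 h2 => ha i h1 (by omega))
      (interior_subset hx) hpq hvq hw.symm
    refine mem_cylinder.2 fun i hi => ?_
    rcases hi.2.eq_or_lt with rfl | hlt
    · rw [zpow_add_one_apply, ← hw]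
      exact P.map_bracket_mem (ha q hpq (by omega)) hvq (hUR x hx) (interior_subset hv.2)
    · exact h1 i ⟨hi.1, by omega⟩

/-- Cylinders of allowed words are the closures of their interiors. -/
theorem cylinder_subset_closure (P : IsSmallPartition S e₁ e₂ R) (hp : p ≤ 0) (hq : 0 ≤ q)
    (ha : ∀ i, p ≤ i → i < q → Transition φ R (a i) (a (i + 1))) :
    cylinder φ R a p q ⊆ closure (interior (cylinder φ R a p q)) := by
  intro t ht
  have htR := mem_cylinder.1 ht
  have hpI : p ∈ Icc p q := ⟨le_rfl, hp.trans hq⟩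
  have hqI : q ∈ Icc p q := ⟨hp.trans hq, le_rfl⟩
  have he := P.eps'.1
  rw [mem_closure_iff_nhds]
  intro N hN
  have hcont : Tendsto (fun x : X × X => S.bracket x.1 x.2) (𝓝 t ×ˢ 𝓝 t) (𝓝 t) := by
    have := S.continuousAt_bracket (x := t) (y := t) (by simpa using S.eps_pos)
    simpa [ContinuousAt, S.B1, nhds_prod_eq] using this
  obtain ⟨N₁, hN₁, hN₁N⟩ := mem_prod_same_iff.1 (hcont hN)
  -- Points of B stay within `e₁` of each other at all times of the window, so brackets among them
  -- commute with the powers of `φ` there.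
  set B : Set X := ⋂ i ∈ Icc p q, (φ ^ i) ⁻¹' Metric.ball ((φ ^ i) t) (e₁ / 2)
  have hB : IsOpen B := (finite_Icc p q).isOpen_biInter fun i _ =>
    Metric.isOpen_ball.preimage (φ ^ i).continuous
  have htB : t ∈ B := by simp [B, he]
  have hBt : ∀ x ∈ B, ∀ i ∈ Icc p q, dist ((φ ^ i) x) ((φ ^ i) t) < e₁ / 2 := by
    intro x hx i hi
    simpa using mem_iInter₂.1 hx i hi
  have hBB : ∀ x ∈ B, ∀ y ∈ B, ∀ i ∈ Icc p q, dist ((φ ^ i) x) ((φ ^ i) y) ≤ e₁ := by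
    intro x hx y hy i hi
    linarith [dist_triangle_right ((φ ^ i) x) ((φ ^ i) y) ((φ ^ i) t), hBt x hx i hi, hBt y hy i hi]
  set O := interior N₁ ∩ B
  have hO : IsOpen O := isOpen_interior.inter hB
  have htO : t ∈ O := ⟨mem_interior_iff_mem_nhds.2 hN₁, htB⟩
  have hne : ∀ i ∈ Icc p q, (O ∩ (φ ^ i) ⁻¹' interior (R (a i))).Nonempty := by
    intro i hi
    have : t ∈ closure ((φ ^ i) ⁻¹' interior (R (a i))) := by
      rw [← Homeomorph.preimage_closure, ← P.eq_closure]
      exact htR i hi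
    exact mem_closure_iff.1 this O hO htO
  -- Points of V and U need not follow the word: only the last letter of v and the first letter of u
  -- are prescribed.
  set V := O ∩ (φ ^ q) ⁻¹' interior (R (a q))
  set U := O ∩ (φ ^ p) ⁻¹' interior (R (a p))
  have hopen : IsOpen (image2 S.bracket V U) :=
    P.eps'.isOpen_image2_bracket (hO.inter (isOpen_interior.preimage (φ ^ q).continuous))
      (hO.inter (isOpen_interior.preimage (φ ^ p).continuous)) fun v hv u hu => by
        simpa using hBB v hv.1.2 u hu.1.2 0 ⟨hp, hq⟩
  have hsub : image2 S.bracket V U ⊆ cylinder φ R a p q := by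
    rintro _ ⟨v, hv, u, hu, rfl⟩
    have hvt := hBB v hv.1.2 t htB
    have htu := hBB t htB u hu.1.2
    have heq := S.zpow_bracket hp hq fun i hi =>
      (hBB v hv.1.2 u hu.1.2 i hi).trans P.e₁_le_eps
    have hs := S.zpow_bracket hp hq fun i hi => (htu i hi).trans P.e₁_le_eps
    have hg := S.zpow_bracket hp hq fun i hi => (hvt i hi).trans P.e₁_le_eps
    have h1 : S.bracket t u ∈ cylinder φ R a p q :=
      P.mem_cylinder_of_stable ha ht (hp.trans hq) (interior_subset hu.2) (hs p hpI)
    have h2 : S.bracket v t ∈ cylinder φ R a p q :=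
      P.mem_cylinder_of_unstable ha ht (hp.trans hq) (interior_subset hv.2) (hg q hqI)
    have h0 : (0 : ℤ) ∈ Icc p q := ⟨hp, hq⟩
    have h3 := hvt 0 h0
    have h4 := htu 0 h0
    have h5 := hBB v hv.1.2 u hu.1.2 0 h0
    simp only [zpow_zero_apply] at h3 h4 h5
    have h6 : S.bracket v u = S.bracket (S.bracket v t) u :=
      (P.eps'.bracket_bracket_left h3 h5).symm
    have h7 : ∀ i ∈ Icc p q, dist ((φ ^ i) (S.bracket v t)) ((φ ^ i) (S.bracket t u)) ≤ S.eps :=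
      fun i hi => (P.close (mem_cylinder.1 h2 i hi) (mem_cylinder.1 h1 i hi)).trans P.e₁_le_eps
    -- [v, t] and [t, u] lie in the cylinder, and their bracket is [v, u].
    have h8 : S.bracket (S.bracket v t) (S.bracket t u) = S.bracket v u := by
      have h9 := P.eps'.dist_left h4
      rw [S.B3 _ _ _ (h3.trans P.e₁_le_eps) (by simpa using h7 0 h0),
        P.eps'.bracket_bracket_right h5 h4]
      linarith [dist_triangle v t (S.bracket t u), P.eps'.le_half]
    rw [← h8]
    refine mem_cylinder.2 fun i hi => ?_
    rw [S.zpow_bracket hp hq h7 i hi]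
    exact P.bracket_mem (mem_cylinder.1 h2 i hi) (mem_cylinder.1 h1 i hi)
  obtain ⟨v, hv⟩ := hne q hqI
  obtain ⟨u, hu⟩ := hne p hpI
  exact ⟨S.bracket v u,
    hN₁N (mem_prod.2 ⟨interior_subset hv.1.1, interior_subset hu.1.1⟩ : (v, u) ∈ N₁ ×ˢ N₁),
    interior_maximal hsub hopen ⟨v, hv, u, hu, rfl⟩⟩

end IsSmallPartition

end Markov

/-! ### The family of cylinders: Markov property, diameters, multiplicity -/

section CylinderFamilies

variable {X : Type*} {l : ℕ}

theorem cylinders_finite [TopologicalSpace X] (φ : X ≃ₜ X) (R : Fin l → Set X) (p q : ℤ) :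
    (cylinders φ R p q).Finite := by
  refine (finite_range fun f : Icc p q → Fin l => ⋂ i : Icc p q, (φ ^ (i : ℤ)) ⁻¹' R (f i)).subset ?_
  rintro _ ⟨a, rfl, -⟩
  exact ⟨fun i => a i, (biInter_eq_iInter (Icc p q) fun i _ => (φ ^ i) ⁻¹' R (a i)).symm⟩

theorem refinement_succ [MetricSpace X] (φ : X ≃ₜ X) (R : Fin l → Set X) (n : ℕ) :
    refinement φ (range R) (n + 1) = cylinders φ R (-n) n := by
  ext A
  constructor
  · rintro ⟨⟨w, hw, rfl⟩, hne⟩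
    have hex : ∀ i, ∃ j, i ∈ Icc (-(n : ℤ)) n → w i = (φ ^ i) ⁻¹' R j := by
      intro i
      by_cases hi : i ∈ Icc (-(n : ℤ)) n
      · obtain ⟨_, ⟨j, rfl⟩, hj⟩ := hw i hi
        exact ⟨j, fun _ => hj.symm⟩
      -- Letters outside the window are arbitrary; time 0 always lies in the window, so its letter
      -- serves as default.
      · obtain ⟨_, ⟨j, rfl⟩, -⟩ := hw 0 ⟨by omega, by omega⟩
        exact ⟨j, fun h => absurd h hi⟩
    choose a ha using hex
    exact ⟨a, iInter₂_congr fun i hi => ha i hi, hne⟩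
  · rintro ⟨a, rfl, hne⟩
    exact ⟨⟨fun i => (φ ^ i) ⁻¹' R (a i), fun i _ => mem_image_of_mem _ (mem_range_self _), rfl⟩,
      hne⟩

variable [MetricSpace X] {φ : X ≃ₜ X} {S : SmaleSpace φ} {e₁ e₂ : ℝ} {R : Fin l → Set X}
  {a b : ℤ → Fin l} {p q p' q' : ℤ}

namespace IsSmallPartition

theorem eq_of_mem_interior_cylinder (P : IsSmallPartition S e₁ e₂ R) {x : X}
    (ha : x ∈ interior (cylinder φ R a p q)) (hb : x ∈ interior (cylinder φ R b p' q')) {i : ℤ}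
    (hi : i ∈ Icc p q) (hi' : i ∈ Icc p' q') : a i = b i :=
  P.eq_of_mem_interior (mem_interior_cylinder.1 ha i hi) (mem_interior_cylinder.1 hb i hi')

/-- Different rectangles have disjoint interiors, so a common interior point forces equal letters at
common times. -/
theorem cylinder_subset_of_mem_interior (P : IsSmallPartition S e₁ e₂ R) (hp : p' ≤ p)
    (hq : q ≤ q') {x : X} (ha : x ∈ interior (cylinder φ R a p' q'))
    (hb : x ∈ interior (cylinder φ R b p q)) : cylinder φ R a p' q' ⊆ cylinder φ R b p q := by
  rw [← cylinder_congr fun i hi =>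
    P.eq_of_mem_interior_cylinder ha hb ⟨hp.trans hi.1, hi.2.trans hq⟩ hi]
  exact cylinder_anti hp hq

theorem isClosed_cylinder (P : IsSmallPartition S e₁ e₂ R) : IsClosed (cylinder φ R a p q) :=
  isClosed_biInter fun i _ => (P.isClosed (a i)).preimage (φ ^ i).continuous

theorem isClosed_of_mem_cylinders (P : IsSmallPartition S e₁ e₂ R) {A : Set X}
    (hA : A ∈ cylinders φ R p q) : IsClosed A := by
  obtain ⟨a, rfl, -⟩ := hA
  exact P.isClosed_cylinder

theorem eq_closure_of_mem_cylinders (P : IsSmallPartition S e₁ e₂ R) (hp : p ≤ 0) (hq : 0 ≤ q)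
    {A : Set X} (hA : A ∈ cylinders φ R p q) : A = closure (interior A) := by
  have hcl := P.isClosed_of_mem_cylinders hA
  obtain ⟨a, rfl, x, hx⟩ := hA
  exact (P.cylinder_subset_closure hp hq (transition_of_mem_interior_cylinder hx)).antisymm
    (hcl.closure_subset_iff.2 interior_subset)

theorem eq_of_interior_inter (P : IsSmallPartition S e₁ e₂ R) {A B : Set X}
    (hA : A ∈ cylinders φ R p q) (hB : B ∈ cylinders φ R p q) {x : X} (hxA : x ∈ interior A)
    (hxB : x ∈ interior B) : A = B := by
  obtain ⟨a, rfl, -⟩ := hA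
  obtain ⟨b, rfl, -⟩ := hB
  exact (P.cylinder_subset_of_mem_interior le_rfl le_rfl hxA hxB).antisymm
    (P.cylinder_subset_of_mem_interior le_rfl le_rfl hxB hxA)

theorem dense_iUnion_interior (P : IsSmallPartition S e₁ e₂ R) :
    Dense (⋃ j, interior (R j)) := by
  rw [dense_iff_closure_eq, closure_iUnion_of_finite, ← P.markov.cover, sUnion_range]
  exact iUnion_congr fun j => (P.eq_closure j).symm

/-- Points whose orbit stays in interiors of rectangles during the window form a finite intersection
of dense open sets, and each lies in the interior of the cylinder of its itinerary. -/
theorem dense_interior_cylinders [CompactSpace X] [Nonempty X] (P : IsSmallPartition S e₁ e₂ R)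
    (p q : ℤ) : Dense (⋃ A ∈ cylinders φ R p q, interior A) := by
  have hd : Dense (⋂ i ∈ Icc p q, (φ ^ i) ⁻¹' ⋃ j, interior (R j)) :=
    dense_biInter_of_isOpen
      (fun i _ => (isOpen_iUnion fun _ => isOpen_interior).preimage (φ ^ i).continuous)
      (finite_Icc p q).countable
      fun i _ => P.dense_iUnion_interior.preimage (φ ^ i).isOpenMap
  obtain ⟨x, hx⟩ := P.dense_iUnion_interior.nonempty
  obtain ⟨j₀, -⟩ := mem_iUnion.1 hx
  refine hd.mono fun x hx => ?_
  have : ∀ i, ∃ j, i ∈ Icc p q → (φ ^ i) x ∈ interior (R j) := by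
    intro i
    by_cases hi : i ∈ Icc p q
    · obtain ⟨j, hj⟩ := mem_iUnion.1 (mem_iInter₂.1 hx i hi)
      exact ⟨j, fun _ => hj⟩
    · exact ⟨j₀, fun h => absurd h hi⟩
  choose a ha using this
  have hxa : x ∈ interior (cylinder φ R a p q) := mem_interior_cylinder.2 fun i hi => ha i hi
  exact mem_iUnion₂.2 ⟨_, ⟨a, rfl, x, hxa⟩, hxa⟩

theorem sUnion_cylinders [CompactSpace X] [Nonempty X] (P : IsSmallPartition S e₁ e₂ R)
    (p q : ℤ) : ⋃₀ cylinders φ R p q = univ := by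
  have hc : IsClosed (⋃ A ∈ cylinders φ R p q, A) :=
    (cylinders_finite φ R p q).isClosed_biUnion fun A hA => P.isClosed_of_mem_cylinders hA
  rw [sUnion_eq_biUnion, ← hc.closure_eq]
  exact ((P.dense_interior_cylinders p q).mono
    (iUnion₂_mono fun _ _ => interior_subset)).closure_eq

theorem cylinders_nonempty [CompactSpace X] [Nonempty X] (P : IsSmallPartition S e₁ e₂ R)
    (p q : ℤ) : (cylinders φ R p q).Nonempty := by
  rw [nonempty_iff_ne_empty]
  intro h
  have := P.sUnion_cylinders p q
  rw [h, sUnion_empty] at this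
  exact empty_ne_univ this

/-- If x and φ x are interior to the cylinders of a and b, then b is a shifted by one place. All
letters but one are thus inherited, and the remaining one, at p for the unstable and at q for the
stable inclusion, is the one-step Markov property. -/
theorem isMarkovPartition_cylinders [CompactSpace X] [Nonempty X] (P : IsSmallPartition S e₁ e₂ R)
    (hp : p ≤ 0) (hq : 0 ≤ q) : S.IsMarkovPartition e₁ (cylinders φ R p q) := by
  have h0 : (0 : ℤ) ∈ Icc p q := ⟨hp, hq⟩
  have hpI : p ∈ Icc p q := ⟨le_rfl, hp.trans hq⟩
  have hqI : q ∈ Icc p q := ⟨hp.trans hq, le_rfl⟩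
  have he := P.eps'.1
  have hcl : ∀ {c : ℤ → Fin l} {x y : X}, x ∈ cylinder φ R c p q → y ∈ cylinder φ R c p q →
      ∀ i ∈ Icc p q, dist ((φ ^ i) x) ((φ ^ i) y) ≤ S.eps := fun hx hy i hi =>
    (P.close (mem_cylinder.1 hx i hi) (mem_cylinder.1 hy i hi)).trans P.e₁_le_eps
  have hcl0 : ∀ {c : ℤ → Fin l} {x y : X}, x ∈ cylinder φ R c p q → y ∈ cylinder φ R c p q →
      dist x y ≤ e₁ := fun {c x y} hx hy => by
    simpa using P.close (mem_cylinder.1 hx 0 h0) (mem_cylinder.1 hy 0 h0)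
  have hshift : ∀ (i : ℤ) (x : X), (φ ^ i) (φ x) = (φ ^ (i + 1)) x := fun i x => by
    rw [zpow_add_apply, zpow_one]
  refine ⟨cylinders_finite φ R p q, P.sUnion_cylinders p q, fun A hA =>
    ⟨?_, P.isClosed_of_mem_cylinders hA, P.eq_closure_of_mem_cylinders hp hq hA⟩, ?_, ?_, ?_⟩
  · obtain ⟨a, rfl, hne⟩ := hA
    refine ⟨hne.mono interior_subset, Metric.ediam_le_of_forall_dist_le fun x hx y hy =>
      hcl0 hx hy, fun x hx y hy => mem_cylinder.2 fun i hi => ?_⟩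
    rw [S.zpow_bracket hp hq (hcl hx hy) i hi]
    exact P.bracket_mem (mem_cylinder.1 hx i hi) (mem_cylinder.1 hy i hi)
  · intro A hA B hB hne
    by_contra h
    obtain ⟨x, hx⟩ := nonempty_iff_ne_empty.2 h
    exact hne (P.eq_of_interior_inter hA hB hx.1 hx.2)
  · rintro _ ⟨a, rfl, -⟩ _ ⟨b, rfl, -⟩ x ⟨hxa, hxb⟩ y ⟨⟨-, hbr⟩, hyb⟩
    have hxa' := interior_subset hxa
    have hxb' : φ x ∈ cylinder φ R b p q := interior_subset hxb
    rw [mem_preimage, mem_interior_cylinder] at hxb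
    rw [mem_interior_cylinder] at hxa
    obtain ⟨z, rfl⟩ := φ.surjective y
    have hz : z ∈ cylinder φ R a p q := by
      refine mem_cylinder.2 fun i hi => ?_
      -- Only the letter of a at time p has no counterpart in b.
      rcases hi.1.eq_or_lt with rfl | hlt
      · have htr : Transition φ R (a p) (b p) :=
          ⟨_, hxa p hpI, by rw [mem_preimage, ← zpow_add_one_apply, ← hshift]; exact hxb p hpI⟩
        have h1 := mem_cylinder.1 hyb p hpI
        have h2 := mem_cylinder.1 hxb' p hpI
        have h3 := S.zpow_bracket hp hq (hcl hyb hxb') p hpI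
        rw [hbr] at h3
        rw [hshift, zpow_add_one_apply] at h1 h2
        obtain ⟨z', hz', he⟩ := P.symm_bracket_mem htr h1 h2 (mem_cylinder.1 hxa' p hpI)
        rw [hshift, hshift, zpow_add_one_apply, zpow_add_one_apply, ← he] at h3
        rwa [φ.injective h3]
      · obtain ⟨m, rfl⟩ : ∃ m, i = m + 1 := ⟨i - 1, by omega⟩
        have hm : m ∈ Icc p q := ⟨by omega, by have := hi.2; omega⟩
        have h1 := hxb m hm
        rw [hshift] at h1
        rw [P.eq_of_mem_interior (hxa _ hi) h1, ← hshift]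
        exact mem_cylinder.1 hyb m hm
    refine ⟨z, ⟨⟨?_, φ.injective ?_⟩, hz⟩, rfl⟩
    · linarith [hcl0 hxa' hz]
    · rw [S.B4 _ _ ((hcl0 hz hxa').trans P.e₁_le_eps) ((hcl0 hyb hxb').trans P.e₁_le_eps), hbr]
  · rintro _ ⟨a, rfl, -⟩ _ ⟨b, rfl, -⟩ x ⟨hxa, hxb⟩ _ ⟨z, ⟨⟨-, hbr⟩, hz⟩, rfl⟩
    have hxa' := interior_subset hxa
    have hxb' : φ x ∈ cylinder φ R b p q := interior_subset hxb
    rw [mem_preimage, mem_interior_cylinder] at hxb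
    rw [mem_interior_cylinder] at hxa
    have hzb : φ z ∈ cylinder φ R b p q := by
      refine mem_cylinder.2 fun i hi => ?_
      rw [hshift]
      -- Only the letter of b at time q has no counterpart in a.
      rcases hi.2.eq_or_lt with rfl | hlt
      · have h1 := hxb i hi
        rw [hshift, zpow_add_one_apply] at h1
        have h3 := P.map_bracket_mem ⟨_, hxa i hi, h1⟩ (mem_cylinder.1 hxa' i hi)
          (mem_cylinder.1 hz i hi) (interior_subset h1)
        rwa [← S.zpow_bracket hp hq (hcl hxa' hz) i hi, hbr, ← zpow_add_one_apply] at h3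
      · have hi1 : i + 1 ∈ Icc p q := ⟨by have := hi.1; omega, by omega⟩
        have h1 := hxb i hi
        rw [hshift] at h1
        rw [← P.eq_of_mem_interior (hxa _ hi1) h1]
        exact mem_cylinder.1 hz _ hi1
    refine ⟨⟨?_, ?_⟩, hzb⟩
    · linarith [hcl0 hxb' hzb]
    · rw [← S.B4 _ _ ((hcl0 hxa' hz).trans P.e₁_le_eps) ((hcl0 hxb' hzb).trans P.e₁_le_eps), hbr]

/-- Points of a cylinder on the same local unstable set. -/
theorem dist_le_of_unstable (P : IsSmallPartition S e₁ e₂ R) (hp : p ≤ 0) {t w : X}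
    (ht : t ∈ cylinder φ R a p q) (hw : w ∈ cylinder φ R a p q) (h : S.bracket w t = w) (n : ℕ)
    (hn : n ≤ q) : dist w t ≤ (S.lam⁻¹) ^ n * e₂ := by
  have hlam : 0 ≤ S.lam⁻¹ := inv_nonneg.2 (by linarith [S.one_lt_lam])
  -- The relation [w, t] = w passes to the forward iterates in the window, so C2 contracts at each
  -- step back from time k to time 0.
  have key : ∀ k : ℕ, k ≤ n →
      dist w t ≤ (S.lam⁻¹) ^ k * dist ((φ ^ (k : ℤ)) w) ((φ ^ (k : ℤ)) t) := by
    intro k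
    induction k with
    | zero => intro _; simp
    | succ k ih =>
      intro hk
      have hI : ((k + 1 : ℕ) : ℤ) ∈ Icc p q := ⟨by omega, by omega⟩
      have h1 := P.close (mem_cylinder.1 ht _ hI) (mem_cylinder.1 hw _ hI)
      have h2 := S.zpow_bracket hp (by omega) (fun i hi =>
        (P.close (mem_cylinder.1 hw i hi) (mem_cylinder.1 ht i hi)).trans P.e₁_le_eps) _ hI
      rw [h] at h2
      have h3 := S.C2 ((φ ^ ((k + 1 : ℕ) : ℤ)) t) S.eps S.eps_pos le_rfl
        ((φ ^ ((k + 1 : ℕ) : ℤ)) w) ⟨by linarith [P.eps'.le_half, S.eps_pos], h2.symm⟩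
        ((φ ^ ((k + 1 : ℕ) : ℤ)) t) ⟨by simpa using S.eps_pos, S.B1 _⟩
      have h4 : ∀ x, φ.symm ((φ ^ ((k + 1 : ℕ) : ℤ)) x) = (φ ^ (k : ℤ)) x := by
        intro x
        rw [Nat.cast_succ, zpow_add_one_apply, Homeomorph.symm_apply_apply]
      rw [h4, h4] at h3
      refine (ih (by omega)).trans ?_
      rw [pow_succ, mul_assoc]
      exact mul_le_mul_of_nonneg_left h3 (pow_nonneg hlam k)
  have hI : (n : ℤ) ∈ Icc p q := ⟨by omega, hn⟩
  exact (key n le_rfl).trans (mul_le_mul_of_nonneg_left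
    (P.dist_le _ _ (mem_cylinder.1 hw _ hI) _ (mem_cylinder.1 ht _ hI)) (pow_nonneg hlam n))

/-- Points of a cylinder on the same local stable set. -/
theorem dist_le_of_stable (P : IsSmallPartition S e₁ e₂ R) (hq : 0 ≤ q) {t w : X}
    (ht : t ∈ cylinder φ R a p q) (hw : w ∈ cylinder φ R a p q) (h : S.bracket t w = w) (n : ℕ)
    (hn : p ≤ -n) : dist t w ≤ (S.lam⁻¹) ^ n * e₂ := by
  have hlam : 0 ≤ S.lam⁻¹ := inv_nonneg.2 (by linarith [S.one_lt_lam])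
  have key : ∀ k : ℕ, k ≤ n →
      dist t w ≤ (S.lam⁻¹) ^ k * dist ((φ ^ (-k : ℤ)) t) ((φ ^ (-k : ℤ)) w) := by
    intro k
    induction k with
    | zero => intro _; simp
    | succ k ih =>
      intro hk
      have hI : (-(k + 1 : ℕ) : ℤ) ∈ Icc p q := ⟨by omega, by omega⟩
      have h1 := P.close (mem_cylinder.1 ht _ hI) (mem_cylinder.1 hw _ hI)
      have h2 := S.zpow_bracket (by omega) hq (fun i hi =>
        (P.close (mem_cylinder.1 ht i hi) (mem_cylinder.1 hw i hi)).trans P.e₁_le_eps) _ hI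
      rw [h] at h2
      have h3 := S.C1 ((φ ^ (-(k + 1 : ℕ) : ℤ)) t) S.eps S.eps_pos le_rfl
        ((φ ^ (-(k + 1 : ℕ) : ℤ)) t) ⟨by simpa using S.eps_pos, S.B1 _⟩
        ((φ ^ (-(k + 1 : ℕ) : ℤ)) w) ⟨by linarith [P.eps'.le_half, S.eps_pos], h2.symm⟩
      have h4 : (-(k + 1 : ℕ) : ℤ) + 1 = -k := by omega
      rw [← zpow_add_one_apply, ← zpow_add_one_apply, h4] at h3
      refine (ih (by omega)).trans ?_
      rw [pow_succ, mul_assoc]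
      exact mul_le_mul_of_nonneg_left h3 (pow_nonneg hlam k)
  have hI : (-n : ℤ) ∈ Icc p q := ⟨hn, by omega⟩
  exact (key n le_rfl).trans (mul_le_mul_of_nonneg_left
    (P.dist_le _ _ (mem_cylinder.1 ht _ hI) _ (mem_cylinder.1 hw _ hI)) (pow_nonneg hlam n))

/-- Go from x to [x, y] along the stable direction, contracted from time -n on, and from there to y
along the unstable direction, contracted backward from time n. -/
theorem dist_le_of_mem_cylinder (P : IsSmallPartition S e₁ e₂ R) {n : ℕ} (hp : p ≤ -n) (hq : n ≤ q)
    {x y : X} (hx : x ∈ cylinder φ R a p q) (hy : y ∈ cylinder φ R a p q) :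
    dist x y ≤ (S.lam⁻¹) ^ n * (2 * e₂) := by
  have h0 : (0 : ℤ) ∈ Icc p q := ⟨by omega, by omega⟩
  have hxy : dist x y ≤ e₁ := by
    simpa using P.close (mem_cylinder.1 hx 0 h0) (mem_cylinder.1 hy 0 h0)
  have hw : S.bracket x y ∈ cylinder φ R a p q := by
    refine mem_cylinder.2 fun i hi => ?_
    rw [S.zpow_bracket h0.1 h0.2 (fun i hi => (P.close (mem_cylinder.1 hx i hi)
      (mem_cylinder.1 hy i hi)).trans P.e₁_le_eps) i hi]
    exact P.bracket_mem (mem_cylinder.1 hx i hi) (mem_cylinder.1 hy i hi)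
  have h1 := P.dist_le_of_unstable h0.1 hy hw (P.eps'.bracket_bracket_left hxy hxy) n hq
  have h2 := P.dist_le_of_stable h0.2 hx hw (P.eps'.bracket_bracket_right hxy hxy) n hp
  linarith [dist_triangle x (S.bracket x y) y]

/-- The first and last letters determine a cylinder among those with nearby points. -/
theorem exists_ends [Nonempty (Fin l)] (P : IsSmallPartition S e₁ e₂ R) (hp : p ≤ 0) (hq : 0 ≤ q) :
    ∃ f : Set X → Fin l × Fin l, ∀ A ∈ cylinders φ R p q, ∀ B ∈ cylinders φ R p q, f A = f B →
      (∃ y ∈ A, ∃ z ∈ B, ∀ i ∈ Icc p q, dist ((φ ^ i) y) ((φ ^ i) z) ≤ e₂) → A = B := by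
  classical
  have hex : ∀ A, ∃ a, A ∈ cylinders φ R p q → A = cylinder φ R a p q ∧ (interior A).Nonempty := by
    intro A
    by_cases hA : A ∈ cylinders φ R p q
    · obtain ⟨a, ha⟩ := hA
      exact ⟨a, fun _ => ha⟩
    · exact ⟨fun _ => Classical.arbitrary _, fun h => absurd h hA⟩
  choose w hw using hex
  refine ⟨fun A => (w A p, w A q), fun A hA B hB hf ⟨y, hy, z, hz, hyz⟩ => ?_⟩
  obtain ⟨hA1, hA2⟩ := hw A hA
  obtain ⟨hB1, hB2⟩ := hw B hB
  obtain ⟨hf1, hf2⟩ := Prod.mk.inj hf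
  rw [hA1] at hy hA2
  rw [hB1] at hz hB2
  rw [hA1, hB1]
  refine cylinder_congr (P.word_unique hp hq hA2 hB2 hf1 hf2 fun i hi y' hy' z' hz' => ?_)
  -- Three steps of length at most `e₂` join y' to z', and `3 * e₂ ≤ e₁`.
  have h1 := P.dist_le _ _ hy' _ (mem_cylinder.1 hy i hi)
  have h2 := P.dist_le _ _ (mem_cylinder.1 hz i hi) _ hz'
  linarith [dist_triangle4 y' ((φ ^ i) y) ((φ ^ i) z) z', hyz i hi, P.le_eps', P.eps''.1]

/-- Two cylinders meeting C contain points of C, whose orbits are `e₂`-close throughout the window.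
The pair of end letters is thus injective on the neighbours of C. -/
theorem encard_neighbours_le (P : IsSmallPartition S e₁ e₂ R) (hp : p ≤ 0) (hq : 0 ≤ q)
    {C : Set X} (hC : C ∈ cylinders φ R p q) :
    (neighbours (cylinders φ R p q) C).encard ≤ (l : ℕ∞) ^ 2 := by
  obtain ⟨c, rfl, -⟩ := hC
  have : Nonempty (Fin l) := ⟨c 0⟩
  obtain ⟨f, hf⟩ := P.exists_ends hp hq
  have hinj : InjOn f (neighbours (cylinders φ R p q) (cylinder φ R c p q)) := by
    rintro A ⟨hA, y, hyA, hy⟩ B ⟨hB, z, hzB, hz⟩ hAB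
    exact hf A hA B hB hAB ⟨y, hyA, z, hzB, fun i hi =>
      P.dist_le _ _ (mem_cylinder.1 hy i hi) _ (mem_cylinder.1 hz i hi)⟩
  refine (encard_le_encard_of_injOn (mapsTo_univ _ _) hinj).trans ?_
  simp [sq]

/-- Cylinders with a common point are all neighbours of any one of them. -/
theorem multiplicity_cylinders_le (P : IsSmallPartition S e₁ e₂ R) (hp : p ≤ 0) (hq : 0 ≤ q) :
    multiplicity (cylinders φ R p q) ≤ (l : ℕ∞) ^ 2 := by
  refine iSup₂_le fun F hF => ?_
  obtain ⟨hF, x, hx⟩ := hF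
  rcases F.eq_empty_or_nonempty with rfl | ⟨C, hC⟩
  · simp
  · rw [← encard_coe_eq_coe_finsetCard]
    have hsub : (F : Set (Set X)) ⊆ neighbours (cylinders φ R p q) C := fun A hA =>
      ⟨hF hA, x, hx A hA, hx C hC⟩
    exact (encard_le_encard hsub).trans (P.encard_neighbours_le hp hq (hF hC))

end IsSmallPartition

end CylinderFamilies

/-! ### The essential approximation graph -/

theorem exists_cylinders_superset {X : Type*} {l : ℕ} [TopologicalSpace X] {φ : X ≃ₜ X}
    {R : Fin l → Set X} {p q p' q' : ℤ} (hp : p' ≤ p) (hq : q ≤ q') {w : Set X}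
    (hw : w ∈ cylinders φ R p' q') : ∃ v ∈ cylinders φ R p q, w ⊆ v := by
  obtain ⟨a, rfl, hne⟩ := hw
  exact ⟨_, ⟨a, rfl, hne.mono (interior_mono (cylinder_anti hp hq))⟩, cylinder_anti hp hq⟩

namespace IsSmallPartition

variable {X : Type*} [MetricSpace X] {φ : X ≃ₜ X}
  {S : SmaleSpace φ} {e₁ e₂ : ℝ} {l : ℕ} {R : Fin l → Set X} {p q p' q' : ℤ}

theorem maxDiam_refinement_succ_le (P : IsSmallPartition S e₁ e₂ R) (n : ℕ) :
    maxDiam (refinement φ (range R) (n + 1)) ≤ ENNReal.ofReal ((S.lam⁻¹) ^ n * (2 * e₂)) := by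
  rw [refinement_succ]
  refine iSup₂_le ?_
  rintro _ ⟨a, rfl, -⟩
  exact Metric.ediam_le_of_forall_dist_le fun x hx y hy =>
    P.dist_le_of_mem_cylinder le_rfl le_rfl hx hy

theorem tendsto_maxDiam_refinement (P : IsSmallPartition S e₁ e₂ R) :
    Tendsto (fun n => maxDiam (refinement φ (range R) n)) atTop (𝓝 0) := by
  rw [← tendsto_add_atTop_iff_nat 1]
  have h1 : Tendsto (fun n : ℕ => (S.lam⁻¹) ^ n * (2 * e₂)) atTop (𝓝 0) := by
    simpa using (tendsto_pow_atTop_nhds_zero_of_lt_one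
      (inv_nonneg.2 (by linarith [S.one_lt_lam])) (inv_lt_one_of_one_lt₀ S.one_lt_lam)).mul_const
      (2 * e₂)
  have h2 := ENNReal.tendsto_ofReal h1
  rw [ENNReal.ofReal_zero] at h2
  exact tendsto_of_tendsto_of_tendsto_of_le_of_le tendsto_const_nhds h2 (fun _ => zero_le)
    P.maxDiam_refinement_succ_le

variable [CompactSpace X]

/-- An overlap of two different cylinders is closed, and has empty interior since a common interior
point would make them equal; there are finitely many overlaps. -/
theorem dense_compl_overlaps (P : IsSmallPartition S e₁ e₂ R) :
    Dense (⋃₀ overlaps (cylinders φ R p q))ᶜ := by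
  have hfin : (overlaps (cylinders φ R p q)).Finite := by
    refine (((cylinders_finite φ R p q).prod (cylinders_finite φ R p q)).image
      fun x => closure x.1 ∩ closure x.2).subset ?_
    rintro _ ⟨v, hv, w, hw, -, rfl⟩
    exact ⟨(v, w), ⟨hv, hw⟩, rfl⟩
  rw [compl_sUnion, sInter_image]
  refine dense_biInter_of_isOpen ?_ hfin.countable ?_
  · rintro _ ⟨v, hv, w, hw, -, rfl⟩
    exact (isClosed_closure.inter isClosed_closure).isOpen_compl
  · rintro _ ⟨v, hv, w, hw, hne, rfl⟩
    rw [← interior_eq_empty_iff_dense_compl, interior_inter,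
      (P.isClosed_of_mem_cylinders hv).closure_eq, (P.isClosed_of_mem_cylinders hw).closure_eq]
    by_contra h
    obtain ⟨x, hx⟩ := nonempty_iff_ne_empty.2 h
    exact hne (P.eq_of_interior_inter hv hw hx.1 hx.2)

theorem essPart_nonempty (P : IsSmallPartition S e₁ e₂ R)
    {v : Set X} (hv : v ∈ cylinders φ R p q) : (essPart (cylinders φ R p q) v).Nonempty := by
  obtain ⟨a, rfl, hne⟩ := hv
  exact (P.dense_compl_overlaps).inter_open_nonempty _ isOpen_interior hne

variable [Nonempty X]

theorem exists_subset_meeting (P : IsSmallPartition S e₁ e₂ R) (hp : p' ≤ p) (hq : q ≤ q')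
    {v N : Set X} (hv : v ∈ cylinders φ R p q) (hN : IsOpen N) (hNv : (N ∩ interior v).Nonempty) :
    ∃ w ∈ cylinders φ R p' q', w ⊆ v ∧ (N ∩ w).Nonempty := by
  obtain ⟨x, ⟨hxN, hxv⟩, hxw⟩ :=
    (P.dense_interior_cylinders p' q').inter_open_nonempty _ (hN.inter isOpen_interior) hNv
  obtain ⟨w, hw, hxw⟩ := mem_iUnion₂.1 hxw
  refine ⟨w, hw, ?_, x, hxN, interior_subset hxw⟩
  obtain ⟨a, rfl, -⟩ := hw
  obtain ⟨b, rfl, -⟩ := hv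
  exact P.cylinder_subset_of_mem_interior hp hq hxw hxv

/-- The finer cylinders inside v come arbitrarily close to every point of v, as v is the closure of
its interior; their union is closed because there are finitely many. -/
theorem eq_sUnion_cylinders (P : IsSmallPartition S e₁ e₂ R) (hp0 : p ≤ 0) (hq0 : 0 ≤ q)
    (hp : p' ≤ p) (hq : q ≤ q') {v : Set X} (hv : v ∈ cylinders φ R p q) :
    v = ⋃₀ {w | w ∈ cylinders φ R p' q' ∧ w ⊆ v} := by
  refine Subset.antisymm ?_ (sUnion_subset fun w hw => hw.2)
  have hcl : IsClosed (⋃₀ {w | w ∈ cylinders φ R p' q' ∧ w ⊆ v}) := by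
    rw [sUnion_eq_biUnion]
    exact ((cylinders_finite φ R p' q').subset fun w hw => hw.1).isClosed_biUnion
      fun w hw => P.isClosed_of_mem_cylinders hw.1
  rw [← hcl.closure_eq]
  intro x hx
  rw [P.eq_closure_of_mem_cylinders hp0 hq0 hv] at hx
  refine mem_closure_iff.2 fun N hN hxN => ?_
  obtain ⟨w, hw, hwv, y, hyN, hyw⟩ :=
    P.exists_subset_meeting hp hq hv hN (mem_closure_iff.1 hx N hN hxN)
  exact ⟨y, hyN, w, ⟨hw, hwv⟩, hyw⟩

theorem dense_essPart (P : IsSmallPartition S e₁ e₂ R) :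
    Dense (⋃ v ∈ cylinders φ R p q, essPart (cylinders φ R p q) v) := by
  refine ((P.dense_interior_cylinders p q).inter_of_isOpen_left
    (P.dense_compl_overlaps (p := p) (q := q))
    (isOpen_biUnion fun _ _ => isOpen_interior)).mono ?_
  rintro x ⟨hx, hx'⟩
  obtain ⟨v, hv, hxv⟩ := mem_iUnion₂.1 hx
  exact mem_iUnion₂.2 ⟨v, hv, hxv, hx'⟩

theorem isRefining (P : IsSmallPartition S e₁ e₂ R) : IsRefining (refinement φ (range R)) where
  zero := rfl
  finite n := by
    cases n with
    | zero => exact finite_singleton _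
    | succ n => rw [refinement_succ]; exact cylinders_finite φ R _ _
  cover n := by
    cases n with
    | zero => exact sUnion_singleton _
    | succ n => rw [refinement_succ]; exact P.sUnion_cylinders _ _
  open_or_closed := by
    refine Or.inr fun n v hv => ?_
    cases n with
    | zero =>
      obtain rfl : v = univ := hv
      simp
    | succ n =>
      rw [refinement_succ] at hv
      exact ⟨P.isClosed_of_mem_cylinders hv, by obtain ⟨a, -, h⟩ := hv; exact h⟩
  refines n w hw := by
    cases n with
    | zero => exact ⟨univ, rfl, subset_univ _⟩
    | succ n =>
      rw [refinement_succ] at hw ⊢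
      exact exists_cylinders_superset (by push_cast; omega) (by push_cast; omega) hw
  diam_tendsto := P.tendsto_maxDiam_refinement

theorem isEssential (P : IsSmallPartition S e₁ e₂ R) : IsEssential (refinement φ (range R)) where
  regular :=
    { graph :=
        { refining := P.isRefining
          no_sinks := by
            intro n v hv
            have : ∃ w ∈ refinement φ (range R) (n + 1), w ⊆ v := by
              rw [refinement_succ]
              cases n with
              | zero =>
                obtain rfl : v = univ := hv
                obtain ⟨w, hw⟩ := P.cylinders_nonempty (-((0 : ℕ) : ℤ)) (0 : ℕ)
                exact ⟨w, hw, subset_univ _⟩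
              | succ n =>
                rw [refinement_succ] at hv
                have hne : (interior v).Nonempty := by obtain ⟨a, -, h⟩ := hv; exact h
                obtain ⟨w, hw, hwv, -⟩ := P.exists_subset_meeting (p' := -((n + 1 : ℕ) : ℤ))
                  (q' := (n + 1 : ℕ)) (by push_cast; omega) (by push_cast; omega) hv isOpen_univ
                  (by rwa [univ_inter])
                exact ⟨w, hw, hwv⟩
            obtain ⟨w, hw, hwv⟩ := this
            exact ⟨⟨v, w, hv, hw, hwv⟩, rfl⟩
          no_sources := by
            intro n w hw
            obtain ⟨v, hv, hwv⟩ := P.isRefining.refines n w hw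
            exact ⟨⟨v, w, hv, hw, hwv⟩, rfl⟩ }
      E1 := by
        intro n hn v hv
        obtain ⟨m, rfl⟩ := Nat.exists_eq_add_of_le' hn
        rw [refinement_succ] at hv ⊢
        exact P.eq_sUnion_cylinders (by omega) (by omega) (by push_cast; omega)
          (by push_cast; omega) hv
      E2 := by
        intro n hn v hv
        obtain ⟨m, rfl⟩ := Nat.exists_eq_add_of_le' hn
        rw [refinement_succ] at hv ⊢
        exact P.essPart_nonempty hv }
  closed n v hv := by
    cases n with
    | zero =>
      obtain rfl : v = univ := hv
      exact isClosed_univ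
    | succ n =>
      rw [refinement_succ] at hv
      exact P.isClosed_of_mem_cylinders hv
  dense n hn := by
    obtain ⟨m, rfl⟩ := Nat.exists_eq_add_of_le' hn
    rw [refinement_succ]
    exact P.dense_essPart

end IsSmallPartition

/-! ### Paths and their topology -/

section Paths

variable {X : Type*} {𝒱 : ℕ → Set (Set X)}

/-- Sources carry no information: the first is the unique root, and each later one is the preceding
range. -/
theorem PathSpace.ext_rng (h0 : (𝒱 0).Subsingleton) {x y : PathSpace 𝒱}
    (h : ∀ n, (x.edge n).rng = (y.edge n).rng) : x = y := by
  refine PathSpace.ext (funext fun n => Edge.ext ?_ (h n))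
  cases n with
  | zero => exact h0 (x.edge 0).src_mem (y.edge 0).src_mem
  | succ n => rw [x.src_succ, y.src_succ, h]

theorem PathSpace.isOpen_setOf_edge_eq (x : PathSpace 𝒱) (n : ℕ) :
    IsOpen {y : PathSpace 𝒱 | ∀ i : Fin (n + 1), y.edge i = x.edge i} :=
  TopologicalSpace.isOpen_generateFrom_of_mem
    ⟨n, fun i => x.edge i, fun i => by simpa using x.src_succ i, rfl⟩

end Paths

/-! ### Coding of paths by allowed sequences -/

section Coding

variable {X : Type*} [MetricSpace X] {φ : X ≃ₜ X} {S : SmaleSpace φ} {e₁ e₂ : ℝ} {l : ℕ}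
  {R : Fin l → Set X}

theorem transitionMatrix_eq_one_iff {j k : Fin l} :
    transitionMatrix φ R j k = 1 ↔ Transition φ R j k := by
  simp [transitionMatrix, Transition]

namespace IsSmallPartition

theorem word_eq_of_cylinder_eq (P : IsSmallPartition S e₁ e₂ R) {a b : ℤ → Fin l} {p q : ℤ}
    (h : cylinder φ R a p q = cylinder φ R b p q)
    (ha : (interior (cylinder φ R a p q)).Nonempty) : ∀ i ∈ Icc p q, a i = b i := by
  obtain ⟨x, hx⟩ := ha
  exact fun i hi => P.eq_of_mem_interior_cylinder hx (h ▸ hx) hi hi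

/-- The Markov property enters the coding here: conditions on consecutive letters alone make each
central word a vertex. -/
theorem interior_cylinder_markovChain (P : IsSmallPartition S e₁ e₂ R)
    (x : MarkovChain (transitionMatrix φ R)) (n : ℕ) :
    (interior (cylinder φ R x.1 (-n) n)).Nonempty :=
  P.interior_cylinder_nonempty (by omega) fun i _ _ => transitionMatrix_eq_one_iff.1 (x.2 i)

/-- The vertices of the path of a sequence. -/
def vertex (φ : X ≃ₜ X) (R : Fin l → Set X) (x : ℤ → Fin l) : ℕ → Set X
  | 0 => univ
  | n + 1 => cylinder φ R x (-n) n

theorem vertex_mem (P : IsSmallPartition S e₁ e₂ R) (x : MarkovChain (transitionMatrix φ R))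
    (n : ℕ) : vertex φ R x.1 n ∈ refinement φ (range R) n := by
  cases n with
  | zero => exact mem_singleton _
  | succ n =>
    rw [refinement_succ]
    exact ⟨_, rfl, P.interior_cylinder_markovChain x n⟩

theorem vertex_succ_subset (x : ℤ → Fin l) (n : ℕ) : vertex φ R x (n + 1) ⊆ vertex φ R x n := by
  cases n with
  | zero => exact subset_univ _
  | succ n => exact cylinder_anti (by push_cast; omega) (by push_cast; omega)

/-- The path of an allowable sequence. -/
def toPath (P : IsSmallPartition S e₁ e₂ R) (x : MarkovChain (transitionMatrix φ R)) :
    PathSpace (refinement φ (range R)) where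
  edge n := ⟨_, _, P.vertex_mem x n, P.vertex_mem x (n + 1), vertex_succ_subset x.1 n⟩
  src_succ _ := rfl

theorem toPath_rng (P : IsSmallPartition S e₁ e₂ R) (x : MarkovChain (transitionMatrix φ R))
    (n : ℕ) : ((P.toPath x).edge n).rng = cylinder φ R x.1 (-n) n := rfl

theorem refinement_zero_subsingleton : (refinement φ (range R) 0).Subsingleton :=
  subsingleton_singleton

theorem toPath_edge_congr (P : IsSmallPartition S e₁ e₂ R)
    {x y : MarkovChain (transitionMatrix φ R)} {n : ℕ}
    (h : ∀ i ∈ Icc (-(n : ℤ)) n, x.1 i = y.1 i) : (P.toPath x).edge n = (P.toPath y).edge n := by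
  have key : ∀ m, m ≤ n + 1 → vertex φ R x.1 m = vertex φ R y.1 m := by
    intro m hm
    cases m with
    | zero => rfl
    | succ m => exact cylinder_congr fun i hi => h i ⟨by have := hi.1; omega, by have := hi.2; omega⟩
  exact Edge.ext (key n (by omega)) (key (n + 1) le_rfl)

theorem apply_eq_of_toPath_edge_eq (P : IsSmallPartition S e₁ e₂ R)
    {x y : MarkovChain (transitionMatrix φ R)} {n : ℕ}
    (h : (P.toPath x).edge n = (P.toPath y).edge n) : ∀ i ∈ Icc (-(n : ℤ)) n, x.1 i = y.1 i :=
  P.word_eq_of_cylinder_eq (congrArg Edge.rng h) (P.interior_cylinder_markovChain x n)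

theorem toPath_injective (P : IsSmallPartition S e₁ e₂ R) : Function.Injective P.toPath := by
  intro x y h
  refine Subtype.ext (funext fun i => ?_)
  exact P.apply_eq_of_toPath_edge_eq (n := i.natAbs) (by rw [h]) i ⟨by omega, by omega⟩

theorem toPath_surjective (P : IsSmallPartition S e₁ e₂ R) : Function.Surjective P.toPath := by
  intro y
  have hw : ∀ n, ∃ a, (y.edge n).rng = cylinder φ R a (-n) n ∧
      (interior (cylinder φ R a (-n) n)).Nonempty := by
    intro n
    have := (y.edge n).rng_mem
    rw [refinement_succ] at this
    obtain ⟨a, ha, hne⟩ := this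
    exact ⟨a, ha, ha ▸ hne⟩
  choose a ha hne using hw
  have hsub : ∀ m n, m ≤ n → cylinder φ R (a n) (-n) n ⊆ cylinder φ R (a m) (-m) m := by
    intro m n hmn
    induction n, hmn using Nat.le_induction with
    | base => exact Subset.rfl
    | succ n hmn ih =>
      refine Subset.trans ?_ ih
      rw [← ha (n + 1), ← ha n, ← y.src_succ n]
      exact (y.edge (n + 1)).rng_subset_src
  have hcoh : ∀ m n : ℕ, m ≤ n → ∀ i ∈ Icc (-(m : ℤ)) m, a n i = a m i := by
    intro m n hmn i hi
    obtain ⟨x, hx⟩ := hne n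
    exact P.eq_of_mem_interior_cylinder hx (interior_mono (hsub m n hmn) hx)
      ⟨by have := hi.1; omega, by have := hi.2; omega⟩ hi
  -- Read the letter at i from the first level whose window contains i; `hcoh` makes all later
  -- levels agree.
  set b : ℤ → Fin l := fun i => a i.natAbs i with hb
  have hab : ∀ n : ℕ, ∀ i ∈ Icc (-(n : ℤ)) n, b i = a n i := fun n i hi =>
    (hcoh _ n (by have := hi.1; have := hi.2; omega) i ⟨by omega, by omega⟩).symm
  refine ⟨⟨b, fun i => ?_⟩, PathSpace.ext_rng refinement_zero_subsingleton fun n => ?_⟩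
  · rw [transitionMatrix_eq_one_iff]
    -- One level more, so that the window contains both i and i + 1.
    obtain ⟨x, hx⟩ := hne (i.natAbs + 1)
    rw [← cylinder_congr (hab _)] at hx
    exact transition_of_mem_interior_cylinder hx i (by omega) (by omega)
  · rw [toPath_rng, ha]
    exact cylinder_congr (hab n)

theorem continuous_toPath (P : IsSmallPartition S e₁ e₂ R) : Continuous P.toPath := by
  refine continuous_generateFrom_iff.2 ?_
  rintro _ ⟨n, μ, -, rfl⟩
  rw [isOpen_iff_mem_nhds]
  intro x hx
  have hO : IsOpen {y : MarkovChain (transitionMatrix φ R) |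
      ∀ i ∈ Icc (-(n : ℤ)) n, y.1 i = x.1 i} := by
    have : {y : MarkovChain (transitionMatrix φ R) | ∀ i ∈ Icc (-(n : ℤ)) n, y.1 i = x.1 i} =
        ⋂ i ∈ Icc (-(n : ℤ)) n, (fun y : MarkovChain (transitionMatrix φ R) => y.1 i) ⁻¹' {x.1 i} := by
      ext y; simp
    rw [this]
    exact (finite_Icc _ _).isOpen_biInter fun i _ =>
      (isOpen_discrete _).preimage ((continuous_apply i).comp continuous_subtype_val)
  refine mem_of_superset (hO.mem_nhds fun _ _ => rfl) fun y hy i => ?_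
  rw [← hx i]
  exact P.toPath_edge_congr fun j hj => hy j
    ⟨by have := hj.1; have := i.2; omega, by have := hj.2; have := i.2; omega⟩

/-- The coding of paths by allowable sequences. -/
noncomputable def coding (P : IsSmallPartition S e₁ e₂ R) :
    MarkovChain (transitionMatrix φ R) ≃ₜ PathSpace (refinement φ (range R)) where
  toEquiv := Equiv.ofBijective P.toPath ⟨P.toPath_injective, P.toPath_surjective⟩
  continuous_toFun := P.continuous_toPath
  continuous_invFun := by
    refine Continuous.subtype_mk (f := fun y => ((Equiv.ofBijective P.toPath
      ⟨P.toPath_injective, P.toPath_surjective⟩).symm y).1) (continuous_pi fun i => ?_) _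
    rw [continuous_discrete_rng]
    intro j
    rw [isOpen_iff_mem_nhds]
    intro y hy
    -- The letter at i is already determined by the edge with index |i|.
    refine mem_of_superset ((y.isOpen_setOf_edge_eq i.natAbs).mem_nhds fun _ => rfl) fun z hz => ?_
    obtain ⟨u, rfl⟩ := P.toPath_surjective y
    obtain ⟨v, rfl⟩ := P.toPath_surjective z
    have h1 : ∀ u, (Equiv.ofBijective P.toPath ⟨P.toPath_injective, P.toPath_surjective⟩).symm
        (P.toPath u) = u := fun u => Equiv.ofBijective_symm_apply_apply _ _ u
    rw [mem_preimage, mem_singleton_iff, h1] at hy ⊢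
    rw [← hy]
    exact P.apply_eq_of_toPath_edge_eq (hz (Fin.last _)) i 
      ⟨by rw [Fin.val_last]; omega, by rw [Fin.val_last]; omega⟩

theorem coding_rng (P : IsSmallPartition S e₁ e₂ R) (x : MarkovChain (transitionMatrix φ R))
    (n : ℕ) : ((P.coding x).edge n).rng = cylinder φ R x.1 (-n) n := rfl

/-- The two-sided shift as a homeomorphism. -/
def markovShiftHomeomorph {l : ℕ} (M : Matrix (Fin l) (Fin l) ℕ) :
    MarkovChain M ≃ₜ MarkovChain M where
  toFun := markovShift M
  invFun x := ⟨fun i => x.1 (i - 1), fun i => by simpa using x.2 (i - 1)⟩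
  left_inv x := by simp [markovShift]
  right_inv x := by simp [markovShift]
  continuous_toFun := by
    exact Continuous.subtype_mk (f := fun x : MarkovChain M => fun i => x.1 (i + 1))
      (continuous_pi fun i => (continuous_apply (i + 1)).comp continuous_subtype_val) _
  continuous_invFun := by
    exact Continuous.subtype_mk (f := fun x : MarkovChain M => fun i => x.1 (i - 1))
      (continuous_pi fun i => (continuous_apply (i - 1)).comp continuous_subtype_val) _

/-- The left shift on the path space. -/
noncomputable def pathShift (P : IsSmallPartition S e₁ e₂ R) :
    PathSpace (refinement φ (range R)) ≃ₜ PathSpace (refinement φ (range R)) :=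
  P.coding.symm.trans ((markovShiftHomeomorph _).trans P.coding)

theorem pathShift_coding (P : IsSmallPartition S e₁ e₂ R)
    (x : MarkovChain (transitionMatrix φ R)) :
    P.pathShift (P.coding x) = P.coding (markovShift _ x) := by
  change P.coding (markovShift _ (P.coding.symm (P.coding x))) = _
  rw [Homeomorph.symm_apply_apply]

theorem image_preimage_zpow (φ : X ≃ₜ X) (A : Set X) (i : ℤ) :
    φ '' ((φ ^ (i + 1)) ⁻¹' A) = (φ ^ i) ⁻¹' A := by
  ext x
  obtain ⟨y, rfl⟩ := φ.surjective x
  rw [φ.injective.mem_set_image, mem_preimage, mem_preimage, zpow_add_apply, zpow_one]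

theorem refinement_one (P : IsSmallPartition S e₁ e₂ R) :
    refinement φ (range R) 1 = range R := by
  have key : ∀ a : ℤ → Fin l, cylinder φ R a (-(0 : ℕ)) (0 : ℕ) = R (a 0) := by
    intro a; ext x; simp [mem_cylinder]
  rw [refinement_succ φ R 0]
  ext A
  constructor
  · rintro ⟨a, rfl, -⟩
    rw [key]; exact mem_range_self _
  · rintro ⟨j, rfl⟩
    refine ⟨fun _ => j, (key fun _ => j).symm, ?_⟩
    rw [← closure_nonempty_iff, ← P.eq_closure]
    exact (P.markov.proper _ (mem_range_self _)).1.1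

/-- The sets w i are forced: the vertices of the path determine its letters, so w i is the preimage
of R (x i), and applying `φ` to w (i + 1) moves the letter at i + 1 to place i. -/
theorem isShift_iff (P : IsSmallPartition S e₁ e₂ R)
    (y z : PathSpace (refinement φ (range R))) : IsShift φ y z ↔ z = P.pathShift y := by
  obtain ⟨x, rfl⟩ := P.coding.surjective y
  rw [P.pathShift_coding]
  constructor
  · rintro ⟨w, hw, h1, h2⟩
    have hw' : ∀ i, ∃ j, w i = (φ ^ i) ⁻¹' R j := by
      intro i
      obtain ⟨_, hA, hAw⟩ := hw i
      rw [P.refinement_one] at hA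
      obtain ⟨j, rfl⟩ := hA
      exact ⟨j, hAw.symm⟩
    choose a ha using hw'
    have hax : ∀ i, x.1 i = a i := by
      intro i
      refine P.word_eq_of_cylinder_eq (p := -(i.natAbs : ℤ)) (q := i.natAbs) ?_
        (P.interior_cylinder_markovChain x _) i ⟨by omega, by omega⟩
      rw [← P.coding_rng, h1]
      exact iInter₂_congr fun k _ => ha k
    refine PathSpace.ext_rng refinement_zero_subsingleton fun n => ?_
    rw [h2, P.coding_rng]
    refine iInter₂_congr fun i _ => ?_
    rw [ha, image_preimage_zpow, ← hax]
    rfl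
  · rintro rfl
    refine ⟨fun i => (φ ^ i) ⁻¹' R (x.1 i), fun i => ?_, fun n => P.coding_rng x n, fun n => ?_⟩
    · rw [P.refinement_one]
      exact mem_image_of_mem _ (mem_range_self _)
    · rw [P.coding_rng]
      refine iInter₂_congr fun i _ => ?_
      rw [image_preimage_zpow]
      rfl

end IsSmallPartition

end Coding

/-! ### Counting words -/

section Counting

theorem minSubcover_le {X : Type*} {𝒰 : Set (Set X)} {F : Finset (Set X)}
    (hF : (F : Set (Set X)) ⊆ 𝒰) (hc : ⋃₀ (F : Set (Set X)) = univ) :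
    minSubcover 𝒰 ≤ F.card :=
  Nat.sInf_le (show F.card ∈ {k | ∃ F : Finset (Set X), (F : Set (Set X)) ⊆ 𝒰 ∧
    ⋃₀ (F : Set (Set X)) = univ ∧ F.card = k} from ⟨F, hF, hc, rfl⟩)

variable {X : Type*} [TopologicalSpace X] {l : ℕ} {φ : X ≃ₜ X} {R : Fin l → Set X}

theorem zpow_mem_cylinder {a : ℤ → Fin l} {p q : ℤ} (k : ℤ) {x : X} :
    (φ ^ k) x ∈ cylinder φ R a p q ↔ x ∈ cylinder φ R (fun i => a (i - k)) (p + k) (q + k) := by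
  simp only [mem_cylinder]
  constructor
  · intro h i hi
    have := h (i - k) ⟨by linarith [hi.1], by linarith [hi.2]⟩
    rwa [← zpow_add_apply, sub_add_cancel] at this
  · intro h i hi
    have := h (i + k) ⟨by linarith [hi.1], by linarith [hi.2]⟩
    rwa [add_sub_cancel_right, zpow_add_apply] at this

/-- Translating the time window is a preimage under a power of `φ`; hence the number of cylinders
depends only on the length of the window. -/
theorem cylinders_add (p q k : ℤ) :
    cylinders φ R (p + k) (q + k) = (fun A => (φ ^ k) ⁻¹' A) '' cylinders φ R p q := by
  ext A
  constructor
  · rintro ⟨a, rfl, x, hx⟩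
    have h : (φ ^ k) ⁻¹' cylinder φ R (fun i => a (i + k)) p q =
        cylinder φ R a (p + k) (q + k) := by
      ext y
      rw [mem_preimage, zpow_mem_cylinder]
      simp
    refine ⟨_, ⟨_, rfl, (φ ^ k) x, ?_⟩, h⟩
    rwa [← h, ← Homeomorph.preimage_interior] at hx
  · rintro ⟨_, ⟨a, rfl, hne⟩, rfl⟩
    refine ⟨fun i => a (i - k), ext fun y => zpow_mem_cylinder k, ?_⟩
    rw [← Homeomorph.preimage_interior]
    exact hne.preimage (φ ^ k).surjective

theorem ncard_cylinders_add (p q k : ℤ) :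
    (cylinders φ R (p + k) (q + k)).ncard = (cylinders φ R p q).ncard := by
  rw [cylinders_add]
  exact ncard_image_of_injective _ (φ ^ k).surjective.preimage_injective

/-- Cut each word after time q: its cylinder is the intersection of the cylinders of the two pieces.
-/
theorem ncard_cylinders_le_mul {p q r : ℤ} (hpq : p ≤ q + 1) (hqr : q ≤ r) :
    (cylinders φ R p r).ncard ≤ (cylinders φ R p q).ncard * (cylinders φ R (q + 1) r).ncard := by
  have hsub : cylinders φ R p r ⊆
      (fun x : Set X × Set X => x.1 ∩ x.2) '' (cylinders φ R p q ×ˢ cylinders φ R (q + 1) r) := by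
    rintro _ ⟨a, rfl, hne⟩
    have h1 : cylinder φ R a p r ⊆ cylinder φ R a p q := cylinder_anti le_rfl hqr
    have h2 : cylinder φ R a p r ⊆ cylinder φ R a (q + 1) r := cylinder_anti hpq le_rfl
    refine ⟨(_, _), ⟨⟨a, rfl, hne.mono (interior_mono h1)⟩, ⟨a, rfl, hne.mono (interior_mono h2)⟩⟩,
      Subset.antisymm (fun x hx => mem_cylinder.2 fun i hi => ?_) (subset_inter h1 h2)⟩
    rcases le_or_gt i q with h | h
    · exact mem_cylinder.1 hx.1 i ⟨hi.1, h⟩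
    · exact mem_cylinder.1 hx.2 i ⟨h, hi.2⟩
  have hfin := (cylinders_finite φ R p q).prod (cylinders_finite φ R (q + 1) r)
  rw [← ncard_prod]
  exact (ncard_le_ncard hsub (hfin.image _)).trans (ncard_image_le hfin)

/-- The number of allowed words of length `k`. -/
noncomputable def wordCount (φ : X ≃ₜ X) (R : Fin l → Set X) (k : ℕ) : ℕ :=
  (cylinders φ R 0 (k - 1)).ncard

theorem ncard_cylinders_eq_wordCount {p q : ℤ} {k : ℕ} (h : q + 1 - p = k) :
    (cylinders φ R p q).ncard = wordCount φ R k := by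
  rw [wordCount, ← ncard_cylinders_add 0 ((k : ℤ) - 1) p]
  congr 2 <;> omega

theorem wordCount_add_le (m n : ℕ) :
    wordCount φ R (m + n) ≤ wordCount φ R m * wordCount φ R n := by
  have h := ncard_cylinders_le_mul (φ := φ) (R := R) (p := 0) (q := m - 1) (r := m + n - 1)
    (by omega) (by omega)
  rwa [ncard_cylinders_eq_wordCount (p := 0) (q := m + n - 1) (k := m + n) (by push_cast; omega),
    ncard_cylinders_eq_wordCount (p := 0) (q := m - 1) (k := m) (by omega),
    ncard_cylinders_eq_wordCount (p := m - 1 + 1) (k := n) (by omega)] at h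

end Counting

/-! ### Entropy as the growth rate of the number of words -/

section Entropy

theorem ncard_refinement_succ {X : Type*} [MetricSpace X] {l : ℕ} (φ : X ≃ₜ X)
    (R : Fin l → Set X) (n : ℕ) :
    (refinement φ (range R) (n + 1)).ncard = wordCount φ R (2 * n + 1) := by
  rw [refinement_succ]
  exact ncard_cylinders_eq_wordCount (by push_cast; omega)

variable {X : Type*} [MetricSpace X] [CompactSpace X] {φ : X ≃ₜ X} {S : SmaleSpace φ} {e₁ e₂ : ℝ}
  {l : ℕ} {R : Fin l → Set X}

namespace IsSmallPartition

/-- Joins of small balls have at least as many elements as there are words, up to a constant. -/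
theorem exists_cover_wordCount_le (P : IsSmallPartition S e₁ e₂ R) :
    ∃ 𝒰 : Set (Set X), 𝒰.Finite ∧ (∀ U ∈ 𝒰, IsOpen U) ∧ ⋃₀ 𝒰 = univ ∧
      ∀ n : ℕ, 1 ≤ n → ∀ F : Finset (Set X),
        (F : Set (Set X)) ⊆ joinCover {i : ℕ | i < n} (fun i => pullback φ^[i] 𝒰) →
        ⋃₀ (F : Set (Set X)) = univ → wordCount φ R n ≤ F.card * (l * l) := by
  obtain ⟨t, -, htf, ht⟩ := finite_cover_balls_of_compact (isCompact_univ (X := X))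
    (half_pos P.eps''.1)
  refine ⟨(fun x => Metric.ball x (e₂ / 2)) '' t, htf.image _, ?_, ?_, ?_⟩
  · rintro _ ⟨x, -, rfl⟩
    exact Metric.isOpen_ball
  · rw [sUnion_image]
    exact univ_subset_iff.1 ht
  · intro n hn F hF hFc
    rcases (cylinders φ R 0 ((n : ℤ) - 1)).eq_empty_or_nonempty with h | h
    · rw [wordCount, h, ncard_empty]
      exact Nat.zero_le _
    obtain ⟨-, a, -, -⟩ := h
    have : Nonempty (Fin l) := ⟨a 0⟩
    obtain ⟨f, hf⟩ := P.exists_ends (φ := φ) (p := 0) (q := n - 1) le_rfl (by omega)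
    have hex : ∀ A : Set X, ∃ V, A ∈ cylinders φ R 0 ((n : ℤ) - 1) → V ∈ F ∧ (A ∩ V).Nonempty := by
      intro A
      by_cases hA : A ∈ cylinders φ R 0 ((n : ℤ) - 1)
      · obtain ⟨b, -, x, hx⟩ := hA
        obtain ⟨V, hV, hxV⟩ : x ∈ ⋃₀ (F : Set (Set X)) := hFc ▸ mem_univ x
        exact ⟨V, fun _ => ⟨hV, x, interior_subset hx, hxV⟩⟩
      · exact ⟨∅, fun h => absurd h hA⟩
    choose V hV using hex
    -- The balls have radius `e₂ / 2`, so two points of one element of the join have `e₂`-close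
    -- orbits. Cylinders that meet the same element and have the same end letters therefore
    -- coincide.
    have hinj : InjOn (fun A => (V A, f A)) (cylinders φ R 0 ((n : ℤ) - 1)) := by
      intro A hA B hB hAB
      obtain ⟨h1, h2⟩ := Prod.mk.inj hAB
      obtain ⟨hVF, y, hyA, hyV⟩ := hV A hA
      obtain ⟨-, z, hzB, hzV⟩ := hV B hB
      rw [← h1] at hzV
      obtain ⟨w, hw, hVw⟩ := hF hVF
      rw [hVw, mem_iInter₂] at hyV hzV
      refine hf A hA B hB h2 ⟨y, hyA, z, hzB, fun i hi => ?_⟩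
      lift i to ℕ using hi.1
      have hin : i < n := by have := hi.2; omega
      obtain ⟨_, ⟨c, -, rfl⟩, hc⟩ := hw i hin
      have hy := hyV i hin
      have hz := hzV i hin
      rw [← hc] at hy hz
      rw [zpow_natCast_apply, zpow_natCast_apply]
      have hy' : dist (φ^[i] y) c < e₂ / 2 := hy
      have hz' : dist (φ^[i] z) c < e₂ / 2 := hz
      linarith [dist_triangle_right (φ^[i] y) (φ^[i] z) c]
    have := ncard_le_ncard_of_injOn (t := (F : Set (Set X)) ×ˢ (univ : Set (Fin l × Fin l)))
      _ (fun A hA => ⟨(hV A hA).1, mem_univ _⟩) hinj (F.finite_toSet.prod finite_univ)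
    rw [ncard_prod, ncard_coe_finset, ncard_univ, Nat.card_prod, Nat.card_fin] at this
    exact this

variable [Nonempty X]

/-- The join of an open cover has a subcover with at most as many elements as there are words,
up to a bounded change of length. -/
theorem exists_subcover_card_le (P : IsSmallPartition S e₁ e₂ R) {𝒰 : Set (Set X)}
    (ho : ∀ U ∈ 𝒰, IsOpen U) (hc : ⋃₀ 𝒰 = univ) :
    ∃ m : ℕ, ∀ n : ℕ, ∃ F : Finset (Set X),
      (F : Set (Set X)) ⊆ joinCover {i : ℕ | i < n} (fun i => pullback φ^[i] 𝒰) ∧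
      ⋃₀ (F : Set (Set X)) = univ ∧ F.card ≤ wordCount φ R (n + 2 * m) := by
  classical
  obtain ⟨δ, hδ, hball⟩ := lebesgue_number_lemma_of_metric_sUnion isCompact_univ ho hc.symm.subset
  have hlim : Tendsto (fun n : ℕ => (S.lam⁻¹) ^ n * (2 * e₂)) atTop (𝓝 0) := by
    simpa using (tendsto_pow_atTop_nhds_zero_of_lt_one
      (inv_nonneg.2 (by linarith [S.one_lt_lam])) (inv_lt_one_of_one_lt₀ S.one_lt_lam)).mul_const
      (2 * e₂)
  -- Cylinders with m letters on both sides of time 0 have diameter below the Lebesgue number δ.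
  -- Extending the window by m at each end gives this at each time from 0 to n - 1.
  obtain ⟨m, hm⟩ := (hlim.eventually (gt_mem_nhds hδ)).exists
  refine ⟨m, fun n => ?_⟩
  have hex : ∀ A : Set X, ∃ B, A ∈ cylinders φ R (-m) (n - 1 + m) →
      B ∈ joinCover {i : ℕ | i < n} (fun i => pullback φ^[i] 𝒰) ∧ A ⊆ B := by
    intro A
    by_cases hA : A ∈ cylinders φ R (-m) (n - 1 + m)
    swap
    · exact ⟨∅, fun h => absurd h hA⟩
    obtain ⟨a, rfl, x, hx⟩ := hA
    have hx' := interior_subset hx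
    choose U hU hUb using fun i : ℕ => hball (φ^[i] x) (mem_univ _)
    refine ⟨⋂ i ∈ {i : ℕ | i < n}, φ^[i] ⁻¹' U i, fun _ =>
      ⟨⟨_, fun i _ => mem_image_of_mem _ (hU i), rfl⟩, fun y hy => mem_iInter₂.2 fun i hi => ?_⟩⟩
    refine hUb i (lt_of_le_of_lt ?_ hm)
    have hi' : i < n := hi
    have hmem : ∀ z ∈ cylinder φ R a (-m) (n - 1 + m),
        φ^[i] z ∈ cylinder φ R (fun k => a (k + i)) (-m - i) (n - 1 + m - i) := by
      intro z hz
      rw [← zpow_natCast_apply, zpow_mem_cylinder]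
      simpa using hz
    exact P.dist_le_of_mem_cylinder (by omega) (by omega) (hmem y hy) (hmem x hx')
  choose g hg using hex
  have hfin := cylinders_finite φ R (-m) (n - 1 + m)
  refine ⟨hfin.toFinset.image g, ?_, ?_, ?_⟩
  · intro B hB
    obtain ⟨A, hA, rfl⟩ := Finset.mem_image.1 (Finset.mem_coe.1 hB)
    exact (hg A (hfin.mem_toFinset.1 hA)).1
  · refine eq_univ_of_forall fun x => ?_
    obtain ⟨A, hA, hxA⟩ : x ∈ ⋃₀ cylinders φ R (-m) (n - 1 + m) :=
      P.sUnion_cylinders _ _ ▸ mem_univ x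
    exact ⟨g A, Finset.mem_coe.2 (Finset.mem_image_of_mem g (hfin.mem_toFinset.2 hA)),
      (hg A hA).2 hxA⟩
  · rw [← ncard_cylinders_eq_wordCount (p := -m) (q := n - 1 + m) (by push_cast; omega),
      ncard_eq_toFinset_card _ hfin]
    exact Finset.card_image_le

theorem wordCount_pos (P : IsSmallPartition S e₁ e₂ R) (k : ℕ) : 0 < wordCount φ R k :=
  (ncard_pos (cylinders_finite φ R _ _)).2 (P.cylinders_nonempty _ _)

theorem subadditive_log_wordCount (P : IsSmallPartition S e₁ e₂ R) :
    Subadditive fun k => Real.log (wordCount φ R k) := by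
  intro m n
  have h : ∀ k, (0 : ℝ) < wordCount φ R k := fun k => Nat.cast_pos.2 (P.wordCount_pos k)
  rw [← Real.log_mul (h m).ne' (h n).ne']
  exact Real.log_le_log (h _) (by exact_mod_cast wordCount_add_le m n)

theorem tendsto_log_wordCount_div (P : IsSmallPartition S e₁ e₂ R) :
    Tendsto (fun k : ℕ => Real.log (wordCount φ R k) / k) atTop
      (𝓝 P.subadditive_log_wordCount.lim) := by
  refine P.subadditive_log_wordCount.tendsto_lim ⟨0, ?_⟩
  rintro _ ⟨k, rfl⟩
  exact div_nonneg (Real.log_natCast_nonneg _) k.cast_nonneg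

/-- Each open cover costs at most `2 * m` extra letters, and the cover by small balls loses at most
the factor l²; both disappear after division by n. -/
theorem topEntropy_eq (P : IsSmallPartition S e₁ e₂ R) :
    topEntropy φ = (P.subadditive_log_wordCount.lim : EReal) := by
  have hpos : ∀ k, (0 : ℝ) < wordCount φ R k := fun k => Nat.cast_pos.2 (P.wordCount_pos k)
  have hsub : ∀ 𝒰 : Set (Set X), (∀ U ∈ 𝒰, IsOpen U) → ⋃₀ 𝒰 = univ → ∀ n : ℕ,
      ∃ F : Finset (Set X), (F : Set (Set X)) ⊆
        joinCover {i : ℕ | i < n} (fun i => pullback φ^[i] 𝒰) ∧ ⋃₀ (F : Set (Set X)) = univ ∧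
        F.card = minSubcover (joinCover {i : ℕ | i < n} fun i => pullback φ^[i] 𝒰) := by
    intro 𝒰 ho hc n
    obtain ⟨m, hm⟩ := P.exists_subcover_card_le ho hc
    obtain ⟨F, h1, h2, -⟩ := hm n
    -- Some finite subcover exists, so the infimum is attained and is not the default value 0.
    exact Nat.sInf_mem (s := {k | ∃ F : Finset (Set X), (F : Set (Set X)) ⊆
      joinCover {i : ℕ | i < n} (fun i => pullback φ^[i] 𝒰) ∧ ⋃₀ (F : Set (Set X)) = univ ∧
        F.card = k}) ⟨_, F, h1, h2, rfl⟩
  have hNpos : ∀ 𝒰 : Set (Set X), (∀ U ∈ 𝒰, IsOpen U) → ⋃₀ 𝒰 = univ → ∀ n : ℕ,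
      (0 : ℝ) < minSubcover (joinCover {i : ℕ | i < n} fun i => pullback φ^[i] 𝒰) := by
    intro 𝒰 ho hc n
    obtain ⟨F, -, h2, h3⟩ := hsub 𝒰 ho hc n
    rw [← h3, Nat.cast_pos, Finset.card_pos]
    by_contra hne
    rw [Finset.not_nonempty_iff_eq_empty.1 hne, Finset.coe_empty, sUnion_empty] at h2
    exact empty_ne_univ h2
  have hcast : ∀ u : ℕ → ℝ, Tendsto u atTop (𝓝 P.subadditive_log_wordCount.lim) →
      limsup (fun n => (u n : EReal)) atTop = (P.subadditive_log_wordCount.lim : EReal) :=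
    fun u hu => ((continuous_coe_real_ereal.tendsto _).comp hu).limsup_eq
  refine le_antisymm (iSup₂_le fun 𝒰 h𝒰 => ?_) ?_
  · obtain ⟨m, hm⟩ := P.exists_subcover_card_le h𝒰.2.1 h𝒰.2.2
    have hlim := P.tendsto_log_wordCount_div.add
      (tendsto_const_div_atTop_nhds_zero_nat (Real.log (wordCount φ R (2 * m))))
    rw [add_zero] at hlim
    rw [← hcast _ hlim]
    refine limsup_le_limsup (Eventually.of_forall fun n => ?_)
    rw [EReal.coe_le_coe_iff, ← add_div]
    refine div_le_div_of_nonneg_right ?_ n.cast_nonneg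
    obtain ⟨F, h1, h2, h3⟩ := hm n
    refine le_trans (Real.log_le_log (hNpos 𝒰 h𝒰.2.1 h𝒰.2.2 n) ?_)
      (P.subadditive_log_wordCount n (2 * m))
    exact Nat.cast_le.2 ((minSubcover_le h1 h2).trans h3)
  · obtain ⟨𝒰, hfin, ho, hc, hle⟩ := P.exists_cover_wordCount_le
    refine le_trans ?_ (le_iSup₂ (f := fun (𝒰 : Set (Set X)) (_ : 𝒰.Finite ∧
      (∀ U ∈ 𝒰, IsOpen U) ∧ ⋃₀ 𝒰 = univ) => coverEntropy φ 𝒰) 𝒰 ⟨hfin, ho, hc⟩)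
    have hlim := P.tendsto_log_wordCount_div.sub
      (tendsto_const_div_atTop_nhds_zero_nat (Real.log ((l * l : ℕ) : ℝ)))
    rw [sub_zero] at hlim
    rw [← hcast _ hlim]
    refine limsup_le_limsup ?_
    filter_upwards [eventually_ge_atTop 1] with n hn
    rw [EReal.coe_le_coe_iff, ← sub_div]
    refine div_le_div_of_nonneg_right ?_ n.cast_nonneg
    obtain ⟨F, h1, h2, h3⟩ := hsub 𝒰 ho hc n
    have h4 := hle n hn F h1 h2
    rw [h3] at h4
    have h5 : 0 < l * l := Nat.pos_of_mul_pos_left (lt_of_lt_of_le (P.wordCount_pos n) h4)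
    rw [sub_le_iff_le_add, ← Real.log_mul (hNpos 𝒰 ho hc n).ne' (Nat.cast_pos.2 h5).ne']
    exact Real.log_le_log (hpos n) (by exact_mod_cast h4)

theorem exists_ncard_refinement_bounds (P : IsSmallPartition S e₁ e₂ R) {ε : ℝ} (hε : 0 < ε) :
    ∃ n₀ : ℕ, ∀ n : ℕ, n₀ ≤ n →
      Real.exp (2 * (P.subadditive_log_wordCount.lim - ε) * n) <
        ((refinement φ (range R) n).ncard : ℝ) ∧
      ((refinement φ (range R) n).ncard : ℝ) <
        Real.exp (2 * (P.subadditive_log_wordCount.lim + ε) * n) := by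
  set h := P.subadditive_log_wordCount.lim
  have h1 := P.tendsto_log_wordCount_div.eventually
    (Ioo_mem_nhds (show h - ε / 2 < h by linarith) (show h < h + ε / 2 by linarith))
  obtain ⟨k₀, hk₀⟩ := eventually_atTop.1 h1
  -- Words have length 2n - 1 instead of 2n. An error of ε / 2 per letter leaves a margin growing
  -- like ε n, which absorbs the missing letter once n exceeds this bound; no multiplicative
  -- constant is needed.
  obtain ⟨k₁, hk₁⟩ := exists_nat_gt ((|h| + ε) / ε)
  refine ⟨k₀ + k₁ + 1, fun n hn => ?_⟩
  obtain ⟨m, rfl⟩ : ∃ m, n = m + 1 := ⟨n - 1, by omega⟩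
  rw [ncard_refinement_succ]
  have hpos : (0 : ℝ) < wordCount φ R (2 * m + 1) := Nat.cast_pos.2 (P.wordCount_pos _)
  have h2 := hk₀ (2 * m + 1) (by omega)
  have hm : (0 : ℝ) < (2 * m + 1 : ℕ) := by positivity
  obtain ⟨h3, h4⟩ := h2
  rw [lt_div_iff₀ hm] at h3
  rw [div_lt_iff₀ hm] at h4
  have h5 : (|h| + ε) < ε * (m + 1) := by
    rw [div_lt_iff₀ hε] at hk₁
    have : (k₁ : ℝ) ≤ m + 1 := by exact_mod_cast (by omega : k₁ ≤ m + 1)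
    nlinarith
  have h6 := le_abs_self h
  have h7 := neg_abs_le h
  push_cast at h3 h4 ⊢
  constructor
  · rw [← Real.lt_log_iff_exp_lt hpos]
    nlinarith
  · rw [← Real.log_lt_iff_lt_exp hpos]
    nlinarith

end IsSmallPartition

end Entropy

end SmaleMarkov

/-! ### The theorem, with explicit constants -/

theorem mainTheorem4 {X : Type*} [MetricSpace X] [CompactSpace X] [Infinite X]
    (φ : X ≃ₜ X) (S : SmaleMarkov.SmaleSpace φ) (hirr : SmaleMarkov.IsIrreducible φ)
    (e₁ e₂ : ℝ) (he₁ : S.IsEps' e₁) (he₂ : S.IsEps'' e₁ e₂)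
    (l : ℕ) (R : Fin l → Set X) (hinj : Function.Injective R)
    (hR : S.IsMarkovPartition e₁ (Set.range R))
    (hdiam : SmaleMarkov.maxDiam (Set.range R) ≤ ENNReal.ofReal e₂) :
    (∀ n : ℕ, 1 ≤ n → S.IsMarkovPartition e₁ (SmaleMarkov.refinement φ (Set.range R) n)) ∧
    ∃ h : ℝ, SmaleMarkov.topEntropy φ = (h : EReal) ∧
    ∃ θ C c : ℝ, 0 < θ ∧ θ ≤ S.eps ∧ 0 < C ∧ 0 < c ∧
      (∀ n : ℕ, 1 ≤ n → SmaleMarkov.maxDiam (SmaleMarkov.refinement φ (Set.range R) n) ≤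
        ENNReal.ofReal (S.lam ^ (-(n : ℤ) + 1) * θ)) ∧
      (∀ n : ℕ, 1 ≤ n → SmaleMarkov.multiplicity (SmaleMarkov.refinement φ (Set.range R) n) ≤
        (Set.range R).encard ^ 2) ∧
      (⨆ (n : ℕ) (A : Set X) (_ : A ∈ SmaleMarkov.refinement φ (Set.range R) n),
        (SmaleMarkov.neighbours (SmaleMarkov.refinement φ (Set.range R) n) A).encard) < ⊤ ∧
      (∀ ε : ℝ, 0 < ε → ε < 1 → ∃ n₀ : ℕ, ∀ n : ℕ, n₀ ≤ n →
        c * Real.exp (2 * (h - ε) * n) <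
          ((SmaleMarkov.refinement φ (Set.range R) n).ncard : ℝ) ∧
        ((SmaleMarkov.refinement φ (Set.range R) n).ncard : ℝ) <
          C * Real.exp (2 * (h + ε) * n)) ∧
      SmaleMarkov.IsEssential (SmaleMarkov.refinement φ (Set.range R)) ∧
      ∃ shift : SmaleMarkov.PathSpace (SmaleMarkov.refinement φ (Set.range R)) ≃ₜ
          SmaleMarkov.PathSpace (SmaleMarkov.refinement φ (Set.range R)),
        (∀ p q, SmaleMarkov.IsShift φ p q ↔ q = shift p) ∧
        ∃ Φ : SmaleMarkov.MarkovChain (SmaleMarkov.transitionMatrix φ R) ≃ₜ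
            SmaleMarkov.PathSpace (SmaleMarkov.refinement φ (Set.range R)),
          (∀ x, ∀ n : ℕ, ((Φ x).edge n).rng =
            ⋂ i ∈ Set.Icc (-(n : ℤ)) n, (φ ^ i) ⁻¹' R (x.1 i)) ∧
          ∀ x, Φ (SmaleMarkov.markovShift (SmaleMarkov.transitionMatrix φ R) x) = shift (Φ x) := by
  have P : SmaleMarkov.IsSmallPartition S e₁ e₂ R := by
    refine ⟨he₁, he₂, hinj, hR, fun j x hx y hy => ?_⟩
    have h1 : edist x y ≤ ENNReal.ofReal e₂ := by
      refine (Metric.edist_le_ediam_of_mem hx hy).trans (le_trans ?_ hdiam)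
      exact le_iSup₂ (f := fun (U : Set X) (_ : U ∈ range R) => Metric.ediam U) (R j)
        (mem_range_self j)
    rwa [edist_dist, ENNReal.ofReal_le_ofReal_iff he₂.1.le] at h1
  have hl : (range R).encard = (l : ℕ∞) := by
    rw [← image_univ, hinj.encard_image, encard_univ]
    simp
  have hmem : ∀ n : ℕ, 1 ≤ n → ∃ m : ℕ, n = m + 1 ∧
      SmaleMarkov.refinement φ (range R) n = SmaleMarkov.cylinders φ R (-m) m := by
    intro n hn
    obtain ⟨m, rfl⟩ := Nat.exists_eq_add_of_le' hn
    exact ⟨m, rfl, SmaleMarkov.refinement_succ φ R m⟩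
  -- The constants are θ = 2 e₂, which is at most `eps` because `12 * e₂ ≤ e₁ ≤ eps`, and C = c = 1.
  refine ⟨fun n hn => ?_, P.subadditive_log_wordCount.lim, P.topEntropy_eq, 2 * e₂, 1, 1,
    by linarith [he₂.1], by linarith [P.le_eps', P.e₁_le_eps, he₂.1], one_pos, one_pos,
    fun n hn => ?_, fun n hn => ?_, ?_, fun ε hε _ => ?_, P.isEssential, P.pathShift,
    P.isShift_iff, P.coding, P.coding_rng, fun x => (P.pathShift_coding x).symm⟩
  · obtain ⟨m, -, h⟩ := hmem n hn
    rw [h]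
    exact P.isMarkovPartition_cylinders (by omega) (by omega)
  · obtain ⟨m, rfl, -⟩ := hmem n hn
    have h : S.lam ^ (-((m + 1 : ℕ) : ℤ) + 1) = (S.lam⁻¹) ^ m := by
      rw [inv_pow, ← zpow_natCast, ← zpow_neg]
      congr 1
      push_cast
      ring
    rw [h]
    exact P.maxDiam_refinement_succ_le m
  · obtain ⟨m, -, h⟩ := hmem n hn
    rw [h, hl]
    exact P.multiplicity_cylinders_le (by omega) (by omega)
  -- The supremum includes level 0, whose only element is the whole space; this accounts for the 1.
  · have hbound : (⨆ (n : ℕ) (A : Set X) (_ : A ∈ SmaleMarkov.refinement φ (range R) n),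
        (SmaleMarkov.neighbours (SmaleMarkov.refinement φ (range R) n) A).encard) ≤
        max 1 ((l : ℕ∞) ^ 2) := by
      refine iSup_le fun n => iSup₂_le fun A hA => ?_
      cases n with
      | zero =>
        have hsub : SmaleMarkov.neighbours (SmaleMarkov.refinement φ (range R) 0) A ⊆ {univ} :=
          fun B hB => hB.1
        exact (encard_le_encard hsub).trans ((encard_singleton _).le.trans (le_max_left _ _))
      | succ m =>
        rw [SmaleMarkov.refinement_succ] at hA ⊢
        exact (P.encard_neighbours_le (by omega) (by omega) hA).trans (le_max_right _ _)
    refine hbound.trans_lt (max_lt (by simp) ?_)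
    exact_mod_cast ENat.natCast_lt_top (l ^ 2)
  · simpa only [one_mul] using P.exists_ncard_refinement_bounds hε
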